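/- **Theorem.** A *polytope* in $\mathbb{R}^d$ is a union of finitely many simplices (convex hulls of $d+1$ affinely independent points) with pairwise disjoint interiors; it need not be convex or connected. A bounded measurable set $A\subset\mathbb{R}^d$ of positive Lebesgue measure is *spectral* if there is a countable set $\Lambda\subset\mathbb{R}^d$ such that the exponentials $e_\lambda(x)=e^{2\pi i\langle\lambda,x\rangle}$, $\lambda\in\Lambda$, are pairwise orthogonal and complete in $L^2(A)$. For $1\le r\le d-1$, an *$r$-flag* $\Phi$ is a sequence of linear subspaces $V_r\subset V_{r+1}\subset\cdots\subset V_{d-1}\subset V_d=\mathbb{R}^d$ with $\dim V_j=j$, together with, for each $r\le j\le d-1$, a choice of one of the two half-spaces into which $V_j$ divides $V_{j+1}$, called positive (the other one being called negative). For a polytope $A$, consider all sequences of faces $F_r\subset F_{r+1}\subset\cdots\subset F_{d-1}\subset F_d=A$ parallel to $\Phi$, that is, such that for $r\le j\le d-1$ the set $F_j$ is a $j$-dimensional face of $F_{j+1}$ whose affine hull is a translate of $V_j$. Here the faces of $F_{j+1}$ parallel to $V_j$ are the following sets: for each translate $h$ of $V_j$ and each of the two half-spaces $D$ of $V_{j+1}$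 bounded by $V_j$, the closure of the set of those points $y\in h$ near which $F_{j+1}$ coincides with $y+D$, provided that this set is non-empty; one says that $F_{j+1}$ adjoins this face from the side $D$. Put $\varepsilon_j=+1$ if $F_{j+1}$ adjoins $F_j$ from the positive side and $\varepsilon_j=-1$ if it adjoins $F_j$ from the negative side. The *Hadwiger functional* associated to $\Phi$ is $$H_\Phi(A)=\sum \varepsilon_r\varepsilon_{r+1}\cdots\varepsilon_{d-1}\,\mathrm{Vol}_r(F_r),$$ the sum being over all these sequences of faces, and being $0$ if there are none ($\mathrm{Vol}_r$ is $r$-dimensional volume). Let $1\le r\le d-1$, let $A$ be a spectral polytope in $\mathbb{R}^d$, and let $\Phi$ be an $r$-flag. Then there are only finitely many sequences of faces of $A$ parallel to $\Phi$, and $H_\Phi(A)=0$. -/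

import Mathlib

open MeasureTheory Filter Topology

noncomputable section

namespace Hadwiger

/-- A polytope in `ℝ^d`: the union of finitely many (closed, non-degenerate) `d`-dimensional
simplices with pairwise disjoint interiors.  It need be neither convex nor connected. -/
def IsPolytope {d : ℕ} (A : Set (EuclideanSpace ℝ (Fin d))) : Prop :=
  ∃ (N : ℕ) (S : Fin N → Affine.Simplex ℝ (EuclideanSpace ℝ (Fin d)) d),
    (Pairwise fun i j => Disjoint (interior (convexHull ℝ (Set.range (S i).points)))
      (interior (convexHull ℝ (Set.range (S j).points)))) ∧
    A = ⋃ i, convexHull ℝ (Set.range (S i).points)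

/-- The exponential function `e_ξ(x) = exp(2πi⟨ξ, x⟩)` on `ℝ^d`. -/
def expo {d : ℕ} (ξ x : EuclideanSpace ℝ (Fin d)) : ℂ :=
  Complex.exp (2 * Real.pi * Complex.I * ((inner ℝ ξ x : ℝ) : ℂ))

/-- `Λ` is a spectrum for `A`: it is countable and the exponentials `e_λ`, `λ ∈ Λ`, are pairwise
orthogonal in `L²(A)` and complete there, i.e. their finite linear combinations are dense. -/
def IsSpectrum {d : ℕ} (Λ A : Set (EuclideanSpace ℝ (Fin d))) : Prop :=
  Λ.Countable ∧
  (∀ ξ ∈ Λ, ∀ ξ' ∈ Λ, ξ ≠ ξ' →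
    ∫ x in A, expo ξ x * (starRingEnd ℂ) (expo ξ' x) = 0) ∧
  (∀ f : EuclideanSpace ℝ (Fin d) → ℂ, MemLp f 2 (volume.restrict A) →
    ∀ η : ℝ, 0 < η → ∃ g ∈ Submodule.span ℂ (expo '' Λ),
      eLpNorm (f - g) 2 (volume.restrict A) < ENNReal.ofReal η)

/-- A bounded measurable set of positive Lebesgue measure is spectral if it has a spectrum. -/
def IsSpectral {d : ℕ} (A : Set (EuclideanSpace ℝ (Fin d))) : Prop :=
  Bornology.IsBounded A ∧ MeasurableSet A ∧ 0 < volume A ∧ ∃ Λ, IsSpectrum Λ A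

/-- `D` is one of the two closed half-spaces into which the hyperplane `V` of `W` divides `W`:
the set of all `v + t u` with `v ∈ V` and `t ≥ 0`, for some `u ∈ W` outside of `V`. -/
def IsHalfSpace {E : Type*} [AddCommGroup E] [Module ℝ E]
    (V W : Submodule ℝ E) (D : Set E) : Prop :=
  ∃ u ∈ W, u ∉ V ∧ D = {z | ∃ v ∈ V, ∃ t : ℝ, 0 ≤ t ∧ z = v + t • u}

/-- An `r`-flag in `ℝ^d`: nested linear subspaces `V r ⊂ V (r+1) ⊂ ⋯ ⊂ V d = ℝ^d` with
`dim (V j) = j`, and for `r ≤ j < d` a choice `pos j` of one of the two half-spaces of `V (j+1)`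
determined by `V j`, called the positive one.  (Only the indices `r ≤ j ≤ d` carry
information.) -/
structure RFlag (d r : ℕ) where
  /-- the subspaces -/
  V : ℕ → Submodule ℝ (EuclideanSpace ℝ (Fin d))
  /-- the positive (closed) half-spaces -/
  pos : ℕ → Set (EuclideanSpace ℝ (Fin d))
  finrank_eq : ∀ j, r ≤ j → j ≤ d → Module.finrank ℝ (V j) = j
  le_succ : ∀ j, r ≤ j → j < d → V j ≤ V (j + 1)
  isHalfSpace : ∀ j, r ≤ j → j < d → IsHalfSpace (V j) (V (j + 1)) (pos j)

/-- The negative (closed) half-space of `V (j+1)` determined by `V j`, opposite to `pos j`. -/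
def RFlag.neg {d r : ℕ} (Φ : RFlag d r) (j : ℕ) : Set (EuclideanSpace ℝ (Fin d)) :=
  {z | -z ∈ Φ.pos j}

/-- `F` is the facet of the set `G` on some translate `x + V` of the linear subspace `V` which `G`
adjoins from the side of the half-space `D` (a half-space bounded by `V`, in a linear subspace
parallel to `G`): `F` is non-empty, and it is the closure of the set of all points
`y ∈ x + V` such that `G` coincides with the half-space `y + D` in a neighbourhood of `y`.

For a polytope `G` of dimension `k` (in its affine hull) and `dim V = k - 1`, these are its
`(k-1)`-dimensional faces parallel to `V`: one for each hyperplane of the affine hull that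
contains a `(k-1)`-dimensional part of the boundary and for each side from which `G` adjoins
that part. -/
def IsFacet {d : ℕ} (V : Submodule ℝ (EuclideanSpace ℝ (Fin d)))
    (D G F : Set (EuclideanSpace ℝ (Fin d))) : Prop :=
  F.Nonempty ∧ ∃ x, F = closure {y | y - x ∈ V ∧ ∀ᶠ z in 𝓝 y, (z ∈ G ↔ z - y ∈ D)}

/-- The sequences of faces `F r ⊂ F (r+1) ⊂ ⋯ ⊂ F d = A` of `A` that are parallel to the flag `Φ`:
each `F j` is a facet of `F (j+1)` parallel to `V j`, adjoined by `F (j+1)` either from the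
positive or from the negative side.  The entries outside of `r ≤ j ≤ d` carry no information
and are set to fixed values. -/
def faceSequences {d r : ℕ} (Φ : RFlag d r) (A : Set (EuclideanSpace ℝ (Fin d))) :
    Set (ℕ → Set (EuclideanSpace ℝ (Fin d))) :=
  {F | (∀ j < r, F j = ∅) ∧ (∀ j, d ≤ j → F j = A) ∧
    ∀ j, r ≤ j → j < d →
      IsFacet (Φ.V j) (Φ.pos j) (F (j + 1)) (F j) ∨ IsFacet (Φ.V j) (Φ.neg j) (F (j + 1)) (F j)}

open Classical in
/-- The coefficient `ε_j` of a sequence of faces parallel to `Φ`: it is `+1` if `F (j+1)` adjoins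
`F j` from the positive side, and `-1` if it does so from the negative side. -/
def sign {d r : ℕ} (Φ : RFlag d r) (F : ℕ → Set (EuclideanSpace ℝ (Fin d))) (j : ℕ) : ℝ :=
  if IsFacet (Φ.V j) (Φ.pos j) (F (j + 1)) (F j) then 1 else -1

/-- The Hadwiger functional `H_Φ(A) = ∑ ε_r ε_{r+1} ⋯ ε_{d-1} Vol_r(F_r)`, the (finite) sum being
over all sequences of faces of `A` that are parallel to the `r`-flag `Φ`.  Here `Vol_r` is the
`r`-dimensional Hausdorff measure, normalized so as to agree with Lebesgue measure on `ℝ^r`. -/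
def functional {d r : ℕ} (Φ : RFlag d r) (A : Set (EuclideanSpace ℝ (Fin d))) : ℝ :=
  ∑ᶠ F ∈ faceSequences Φ A,
    (∏ j ∈ Finset.Ico r d, sign Φ F j) * (Measure.euclideanHausdorffMeasure r).real (F r)

end Hadwiger

end

/-! Let `F(ξ)` be the integral of `e_ξ` over `A`. Orthogonality makes `F` vanish at every difference
of two distinct points of the spectrum, while the Hadwiger functional governs the size of `F` at
frequencies that grow at widely separated rates along the unit normals `u r, …, u (d-1)` of the
flag.

For a hyperplane `V` with unit normal `u`, integrating along the lines parallel to `u` shows that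
`-2πi⟨ξ, u⟩ F(ξ)` is a sum of integrals over sheets of the boundary, each the graph of an affine
function over `V` (`mul_pieceIntegral_eq_sum`). Let `⟨ξ, u⟩` tend to infinity while the projection
of `ξ` to `V` stays bounded. On a sheet that is not parallel to `V` the restricted frequency tends
to infinity, so its integral vanishes in the limit by the Riemann–Lebesgue lemma. The parallel
sheets are the facets, with the signs of the functional (`exists_norm_mul_pieceIntegral_sub_le`).
Since `IsAdapted` passes from a set to its facets, the argument can be repeated inside them: if each
normal component of `ξ` is large compared with the projection of `ξ` to the subspace below
(`IsLacunary`), then `F(ξ)` times the product of the normal factors is within `ε` of `faceSum`, the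
signed sum of the Fourier integrals of the lowest faces (`finite_sequencesTo_and_asymptotics`).

At `ξ = 0` this sum is the functional. It depends on `ξ` only through the projection to `V r` and
finitely many phases. As the spectrum is relatively dense (`IsSpectrum.exists_norm_sub_le`), it
contains a sequence with bounded projections to `V r` and lacunary mutual differences
(`exists_forall_norm_sub_le_isLacunary`), and at these differences `faceSum` is at most `ε` in norm.
By compactness some of the differences have projections tending to `0` and phases tending to `1`
(`exists_tendsto_pieceIntegral`), so the functional itself is at most `ε` in absolute value. -/

noncomputable section

namespace Hadwiger

/-! ### Fourier integrals of step functions on the line -/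

/-- A real function with one-sided limits that vanishes far to the left and has finitely many
jumps is recovered from its jumps. -/
theorem leftLimit_eq_sum_jumps {f R L : ℝ → ℝ} {M : ℝ} (T : Finset ℝ)
    (hM : ∀ x < -M, f x = 0)
    (hR : ∀ t, ∀ᶠ x in 𝓝[>] t, f x = R t) (hL : ∀ t, ∀ᶠ x in 𝓝[<] t, f x = L t)
    (hRL : ∀ t ∉ T, R t = L t) (hfL : ∀ t ∉ T, f t = L t) (x : ℝ) :
    L x = ∑ t ∈ T with t < x, (R t - L t) := by
  classical
  -- The left limit minus the jumps to the left of `x` is locally constant, hence constant on the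
  -- line, and it is zero far to the left.
  set h : ℝ → ℝ := fun x => L x - ∑ t ∈ T with t < x, (R t - L t) with hh
  have hT : ∀ x : ℝ, ∀ᶠ y in 𝓝 x, ∀ t ∈ T, (t < x → t < y) ∧ (x < t → y < t) := by
    intro x
    rw [Finset.eventually_all]
    intro t _
    have h1 : t < x → ∀ᶠ y in 𝓝 x, t < y := fun h => eventually_gt_nhds h
    have h2 : x < t → ∀ᶠ y in 𝓝 x, y < t := fun h => eventually_lt_nhds h
    exact (eventually_imp_distrib_left.2 h1).and (eventually_imp_distrib_left.2 h2)
  have hloc : ∀ x, ∀ᶠ y in 𝓝 x, h y = h x := by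
    intro x
    have hr : ∀ᶠ y in 𝓝[>] x, h y = h x := by
      filter_upwards [hR x, (hT x).filter_mono nhdsWithin_le_nhds, self_mem_nhdsWithin]
        with y h1 h2 (h3 : x < y)
      have hy : y ∉ T := fun hy => lt_irrefl _ ((h2 y hy).2 h3)
      have e : (∑ t ∈ T with t < y, (R t - L t)) =
          (∑ t ∈ T with t < x, (R t - L t)) + (R x - L x) := by
        rw [Finset.sum_filter, Finset.sum_filter]
        by_cases hx : x ∈ T
        · rw [← Finset.add_sum_erase _ _ hx, ← Finset.add_sum_erase T
            (fun t => if t < x then R t - L t else 0) hx]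
          simp only [h3, if_true, lt_irrefl, if_false, zero_add]
          rw [add_comm]
          congr 1
          refine Finset.sum_congr rfl fun t ht => ?_
          rw [Finset.mem_erase] at ht
          have := h2 t ht.2
          rcases lt_or_gt_of_ne ht.1 with h4 | h4
          · simp [h4, this.1 h4]
          · simp [h4.not_gt, (this.2 h4).not_gt]
        · rw [hRL x hx, sub_self, add_zero]
          refine Finset.sum_congr rfl fun t ht => ?_
          have := h2 t ht
          rcases lt_or_gt_of_ne (fun h : t = x => hx (h ▸ ht)) with h4 | h4
          · simp [h4, this.1 h4]
          · simp [h4.not_gt, (this.2 h4).not_gt]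
      simp only [hh, e, ← hfL y hy, h1]
      ring
    have hl : ∀ᶠ y in 𝓝[<] x, h y = h x := by
      filter_upwards [hL x, (hT x).filter_mono nhdsWithin_le_nhds, self_mem_nhdsWithin]
        with y h1 h2 (h3 : y < x)
      have hy : y ∉ T := fun hy => lt_irrefl _ ((h2 y hy).1 h3)
      have e : (∑ t ∈ T with t < y, (R t - L t)) = ∑ t ∈ T with t < x, (R t - L t) := by
        congr 1
        refine Finset.filter_congr fun t ht => ⟨fun h => h.trans h3, (h2 t ht).1⟩
      simp only [hh, e, ← hfL y hy, h1]
    rw [← nhdsNE_sup_pure, ← nhdsLT_sup_nhdsGT]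
    simp only [eventually_sup]
    exact ⟨⟨hl, hr⟩, by simp⟩
  have hconst : ∀ x y, h x = h y := by
    intro x y
    exact ((IsLocallyConstant.iff_eventually_eq h).2 hloc).apply_eq_of_isPreconnected
      isPreconnected_univ (Set.mem_univ x) (Set.mem_univ y)
  obtain ⟨B, hB⟩ := T.bddBelow
  have hb0 : h (min B (-M) - 1) = 0 := by
    have e : (∑ t ∈ T with t < min B (-M) - 1, (R t - L t)) = 0 := by
      refine Finset.sum_eq_zero fun t ht => ?_
      rw [Finset.mem_filter] at ht
      have := hB ht.1
      have := min_le_left B (-M)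
      linarith [ht.2]
    have e2 : L (min B (-M) - 1) = 0 := by
      obtain ⟨y, h1, h2⟩ := ((hL (min B (-M) - 1)).and self_mem_nhdsWithin).exists
      rw [← h1]
      apply hM
      have := min_le_right B (-M)
      have h2' : y < min B (-M) - 1 := h2
      linarith
    simp only [hh, e, e2, sub_zero]
  have := hconst x (min B (-M) - 1)
  rw [hb0] at this
  simpa [hh, sub_eq_zero] using this

/-- Almost everywhere `f` is the sum of its jumps times indicators of intervals `(t, N)`, with `N`
to the right of everything, and each of these integrates explicitly. Multiplying by `-k` instead of
dividing keeps `k = 0` allowed. -/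
theorem integral_mul_exp_eq_sum_jumps {f R L : ℝ → ℝ} {M : ℝ} (T : Finset ℝ)
    (hM : ∀ x, f x ≠ 0 → |x| ≤ M)
    (hR : ∀ t, ∀ᶠ x in 𝓝[>] t, f x = R t) (hL : ∀ t, ∀ᶠ x in 𝓝[<] t, f x = L t)
    (hRL : ∀ t ∉ T, R t = L t) (hfL : ∀ t ∉ T, f t = L t) (k : ℂ) :
    -k * ∫ x, (f x : ℂ) * Complex.exp (k * x) =
      ∑ t ∈ T, ((R t - L t : ℝ) : ℂ) * Complex.exp (k * t) := by
  classical
  have hM' : ∀ x < -M, f x = 0 := fun x hx => by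
    by_contra h
    have := abs_le.1 (hM x h)
    linarith [this.1]
  have key := leftLimit_eq_sum_jumps T hM' hR hL hRL hfL
  obtain ⟨N, hN⟩ : ∃ N, M < N ∧ -N < -M ∧ (∀ t ∈ T, t < N ∧ -N < t) := by
    obtain ⟨B, hB⟩ := T.bddAbove
    obtain ⟨B', hB'⟩ := T.bddBelow
    refine ⟨max (max (B + 1) (-B' + 1)) (M + 1), ?_, ?_, fun t ht => ⟨?_, ?_⟩⟩
    · linarith [le_max_right (max (B + 1) (-B' + 1)) (M + 1)]
    · linarith [le_max_right (max (B + 1) (-B' + 1)) (M + 1)]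
    · linarith [hB ht, le_max_left (max (B + 1) (-B' + 1)) (M + 1), le_max_left (B + 1) (-B' + 1)]
    · linarith [hB' ht, le_max_left (max (B + 1) (-B' + 1)) (M + 1),
        le_max_right (B + 1) (-B' + 1)]
  obtain ⟨hMN, hNM, hTN⟩ := hN
  -- The jumps add up to the value of `f` beyond its support; this cancels the boundary terms at
  -- `N`.
  have hsum : ∑ t ∈ T, (R t - L t) = 0 := by
    have h1 := key N
    rw [Finset.filter_true_of_mem fun t ht => (hTN t ht).1] at h1
    rw [← h1, ← hfL N fun h => lt_irrefl _ (hTN N h).1]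
    by_contra h
    have := (abs_le.1 (hM N h)).2
    linarith
  have hf : ∀ x ∉ T, (f x : ℂ) * Complex.exp (k * x) =
      ∑ t ∈ T, (Set.Ioo t N).indicator
        (fun x : ℝ => ((R t - L t : ℝ) : ℂ) * Complex.exp (k * x)) x := by
    intro x hx
    by_cases hxN : x < N
    · rw [hfL x hx, key x, Complex.ofReal_sum, Finset.sum_mul, Finset.sum_filter]
      refine Finset.sum_congr rfl fun t ht => ?_
      by_cases h : t < x <;> simp [h, hxN]
    · have : f x = 0 := by
        by_contra h
        have := (abs_le.1 (hM x h)).2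
        linarith
      simp [this, hxN]
  have hae : (fun x : ℝ => (f x : ℂ) * Complex.exp (k * x)) =ᵐ[volume] fun x =>
      ∑ t ∈ T, (Set.Ioo t N).indicator
        (fun x : ℝ => ((R t - L t : ℝ) : ℂ) * Complex.exp (k * x)) x := by
    have : ((T : Set ℝ))ᶜ ∈ ae (volume : Measure ℝ) :=
      (T.finite_toSet.countable).ae_notMem volume
    filter_upwards [this] with x hx using hf x hx
  rw [integral_congr_ae hae, integral_finsetSum]
  · have e : ∀ t ∈ T, -k * ∫ x, (Set.Ioo t N).indicator
        (fun x : ℝ => ((R t - L t : ℝ) : ℂ) * Complex.exp (k * x)) x =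
        ((R t - L t : ℝ) : ℂ) * Complex.exp (k * t) -
          ((R t - L t : ℝ) : ℂ) * Complex.exp (k * N) := by
      intro t ht
      rw [integral_indicator measurableSet_Ioo, integral_const_mul,
        ← integral_Ioc_eq_integral_Ioo, ← intervalIntegral.integral_of_le (hTN t ht).1.le]
      have : ∫ x in t..N, k * Complex.exp (k * x) = Complex.exp (k * N) - Complex.exp (k * t) := by
        apply intervalIntegral.integral_eq_sub_of_hasDerivAt
          (f := fun x : ℝ => Complex.exp (k * x))
        · intro x _
          have h1 : HasDerivAt (fun x : ℝ => k * (x : ℂ)) k x := by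
            simpa using (Complex.ofRealCLM.hasDerivAt (x := x)).const_mul k
          simpa [mul_comm] using h1.cexp
        · apply Continuous.intervalIntegrable
          fun_prop
      rw [intervalIntegral.integral_const_mul] at this
      linear_combination (-((R t - L t : ℝ) : ℂ)) * this
    rw [Finset.mul_sum, Finset.sum_congr rfl e, Finset.sum_sub_distrib, ← Finset.sum_mul,
      ← Complex.ofReal_sum, hsum]
    simp
  · intro t _
    rw [integrable_indicator_iff measurableSet_Ioo]
    apply (Continuous.integrableOn_Icc (by fun_prop) : IntegrableOn _ (Set.Icc t N) _).mono_set
    exact Set.Ioo_subset_Icc_self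

/-! ### Unit normals and half-spaces -/

section Normal

variable {E : Type*} [NormedAddCommGroup E] [InnerProductSpace ℝ E]

/-- `u` is a unit normal of the hyperplane `V` of `W`. -/
structure IsNormal (V W : Submodule ℝ E) (u : E) : Prop where
  norm_eq : ‖u‖ = 1
  inner_eq : ∀ v ∈ V, inner ℝ u v = 0
  mem_iff : ∀ z, z ∈ W ↔ z - (inner ℝ u z : ℝ) • u ∈ V

namespace IsNormal

variable {V W : Submodule ℝ E} {u : E}

theorem inner_self (h : IsNormal V W u) : inner ℝ u u = (1 : ℝ) := by
  rw [real_inner_self_eq_norm_sq, h.norm_eq]; norm_num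

protected theorem neg (h : IsNormal V W u) : IsNormal V W (-u) :=
  ⟨by simp [h.norm_eq], fun v hv => by simp [h.inner_eq v hv], fun z => by simp [h.mem_iff z]⟩

theorem le (h : IsNormal V W u) : V ≤ W := fun v hv => by
  rw [h.mem_iff, h.inner_eq v hv]; simpa using hv

theorem mem (h : IsNormal V W u) : u ∈ W := by
  rw [h.mem_iff, h.inner_self]; simp

theorem add_smul_mem (h : IsNormal V W u) {v : E} (hv : v ∈ V) (t : ℝ) : v + t • u ∈ W :=
  W.add_mem (h.le hv) (W.smul_mem t h.mem)

theorem inner_add_smul (h : IsNormal V W u) {v : E} (hv : v ∈ V) (t : ℝ) :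
    inner ℝ u (v + t • u) = t := by
  rw [inner_add_right, h.inner_eq v hv, inner_smul_right, h.inner_self]; simp

/-- The isometry `V × ℝ ≃ W` given by a unit normal. -/
def equiv (h : IsNormal V W u) : WithLp 2 (V × ℝ) ≃ₗᵢ[ℝ] W where
  toFun p := ⟨p.fst + p.snd • u, h.add_smul_mem p.fst.2 _⟩
  invFun w := WithLp.toLp 2 (⟨w - (inner ℝ u (w : E) : ℝ) • u, (h.mem_iff _).1 w.2⟩,
    inner ℝ u (w : E))
  left_inv p := by
    apply WithLp.ofLp_injective
    refine Prod.ext (Subtype.ext ?_) ?_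
    · simp [h.inner_add_smul p.fst.2]
    · simp [h.inner_add_smul p.fst.2]
  right_inv w := by ext; simp
  map_add' p q := by ext; simp [add_smul]; abel
  map_smul' c p := by ext; simp [mul_smul]
  norm_map' p := by
    rw [← sq_eq_sq₀ (norm_nonneg _) (norm_nonneg _), WithLp.prod_norm_sq_eq_of_L2]
    change ‖(p.fst : E) + p.snd • u‖ ^ 2 = _
    rw [norm_add_sq_real, inner_smul_right, real_inner_comm, h.inner_eq _ p.fst.2, norm_smul,
      h.norm_eq]
    simp

theorem measurePreserving [FiniteDimensional ℝ E] [MeasurableSpace E] [BorelSpace E]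
    (h : IsNormal V W u) :
    MeasurePreserving (fun p : V × ℝ => (⟨p.1 + p.2 • u, h.add_smul_mem p.1.2 _⟩ : W)) :=
  h.equiv.measurePreserving.comp (WithLp.volume_preserving_toLp V ℝ)

theorem measurableEmbedding [FiniteDimensional ℝ E] [MeasurableSpace E] [BorelSpace E]
    (h : IsNormal V W u) :
    MeasurableEmbedding
      (fun p : V × ℝ => (⟨p.1 + p.2 • u, h.add_smul_mem p.1.2 _⟩ : W)) :=
  (h.equiv.toHomeomorph.measurableEmbedding).comp
    (MeasurableEquiv.toLp 2 (V × ℝ)).measurableEmbedding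

end IsNormal

/-- The normal is the normalized component `n` of `w` orthogonal to `V`. As `w` differs from a
positive multiple of it by an element of `V`, both span the same half-space. -/
theorem exists_isNormal_of_isHalfSpace [FiniteDimensional ℝ E] {V W : Submodule ℝ E} (hVW : V ≤ W)
    (hdim : Module.finrank ℝ W = Module.finrank ℝ V + 1) {D : Set E} (hD : IsHalfSpace V W D) :
    ∃ u, IsNormal V W u ∧ D = {z | z ∈ W ∧ 0 ≤ (inner ℝ u z : ℝ)} := by
  obtain ⟨w, hwW, hwV, rfl⟩ := hD
  set p : E := V.starProjection w with hp
  have hpV : p ∈ V := V.starProjection_apply_mem w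
  set n : E := w - p with hn
  have hn0 : n ≠ 0 := fun h => hwV (by rw [sub_eq_zero.1 h]; exact hpV)
  have hnpos : 0 < ‖n‖ := norm_pos_iff.2 hn0
  set u : E := ‖n‖⁻¹ • n with hu
  have hnV : ∀ v ∈ V, inner ℝ n v = (0 : ℝ) := fun v hv =>
    V.starProjection_inner_eq_zero w v hv
  have huV : ∀ v ∈ V, inner ℝ u v = (0 : ℝ) := fun v hv => by
    rw [hu, inner_smul_left, hnV v hv]; simp
  have hu1 : ‖u‖ = 1 := by
    rw [hu, norm_smul, norm_inv, norm_norm, inv_mul_cancel₀ hnpos.ne']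
  have huW : u ∈ W := W.smul_mem _ (W.sub_mem hwW (hVW hpV))
  have hnu : n = ‖n‖ • u := by rw [hu, smul_smul, mul_inv_cancel₀ hnpos.ne', one_smul]
  have huu : inner ℝ u u = (1 : ℝ) := by rw [real_inner_self_eq_norm_sq, hu1]; norm_num
  have huv : u ∉ V := fun h => by
    have := huV u h
    rw [huu] at this
    exact one_ne_zero this
  have hsup : V ⊔ Submodule.span ℝ {u} = W := by
    apply Submodule.eq_of_le_of_finrank_le
    · exact sup_le hVW ((Submodule.span_singleton_le_iff_mem _ _).2 huW)
    · rw [hdim]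
      apply Submodule.finrank_lt_finrank_of_lt
      refine lt_of_le_of_ne le_sup_left fun h => huv ?_
      rw [h]
      exact Submodule.mem_sup_right (Submodule.mem_span_singleton_self u)
  have hmem : ∀ z, z ∈ W ↔ z - (inner ℝ u z : ℝ) • u ∈ V := by
    intro z
    constructor
    · intro hz
      rw [← hsup, Submodule.mem_sup] at hz
      obtain ⟨v, hv, y, hy, rfl⟩ := hz
      obtain ⟨a, rfl⟩ := Submodule.mem_span_singleton.1 hy
      rw [inner_add_right, huV v hv, inner_smul_right, huu]
      simpa using hv
    · intro hz
      have := W.add_mem (hVW hz) (W.smul_mem (inner ℝ u z : ℝ) huW)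
      simpa using this
  refine ⟨u, ⟨hu1, huV, hmem⟩, ?_⟩
  have hw : w = p + ‖n‖ • u := by rw [← hnu, hn]; abel
  ext z
  constructor
  · rintro ⟨v, hv, t, ht, rfl⟩
    refine ⟨W.add_mem (hVW hv) (W.smul_mem t hwW), ?_⟩
    rw [inner_add_right, huV v hv, inner_smul_right, hw, inner_add_right, huV p hpV,
      inner_smul_right, huu]
    simp only [zero_add, mul_one]
    positivity
  · rintro ⟨hzW, hz⟩
    refine ⟨z - (inner ℝ u z : ℝ) • u - (inner ℝ u z / ‖n‖ : ℝ) • p,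
      V.sub_mem ((hmem z).1 hzW) (V.smul_mem _ hpV), inner ℝ u z / ‖n‖, by positivity, ?_⟩
    have e : (inner ℝ u z / ‖n‖ : ℝ) • w = (inner ℝ u z / ‖n‖ : ℝ) • p + (inner ℝ u z : ℝ) • u := by
      nth_rewrite 1 [hw]
      rw [smul_add, smul_smul, div_mul_cancel₀ _ hnpos.ne']
    rw [e]
    abel

end Normal

/-! ### Local structure of polyhedral sets and their facets -/

section Local

variable {E : Type*} [NormedAddCommGroup E] [InnerProductSpace ℝ E]

/-- The value at `x` of the affine function `x ↦ ⟨a, x⟩ + b` encoded by `(a, b)`. -/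
def affineEval (l : E × ℝ) (x : E) : ℝ := inner ℝ l.1 x + l.2

theorem continuous_affineEval (l : E × ℝ) : Continuous (affineEval l) := by
  unfold affineEval; fun_prop

theorem affineEval_add (l : E × ℝ) (x y : E) :
    affineEval l (x + y) = affineEval l x + inner ℝ l.1 y := by
  simp only [affineEval, inner_add_right]; ring

theorem affineEval_eq_add_inner_sub (l : E × ℝ) (x y : E) :
    affineEval l y = affineEval l x + inner ℝ l.1 (y - x) := by
  rw [← affineEval_add]; simp

/-- `G` is a compact subset of `c + W` cut out there, up to its closure, by sign conditions on
finitely many affine functions that are not constant on `c + W`. -/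
structure IsAdapted (W : Submodule ℝ E) (c : E) (L : Finset (E × ℝ)) (G : Set E) : Prop where
  isClosed : IsClosed G
  isBounded : Bornology.IsBounded G
  sub_mem : ∀ y ∈ G, y - c ∈ W
  nonconst : ∀ l ∈ L, ∃ w ∈ W, (inner ℝ l.1 w : ℝ) ≠ 0
  mem_congr : ∀ y z, y - c ∈ W → z - c ∈ W → (∀ l ∈ L, 0 < affineEval l y * affineEval l z) →
    (y ∈ G ↔ z ∈ G)
  subset_closure : G ⊆ closure {y | y ∈ G ∧ ∀ l ∈ L, affineEval l y ≠ 0}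

open Classical in
/-- The affine functions of a family that are not constant in the directions of `V`. -/
def transverse (V : Submodule ℝ E) (L : Finset (E × ℝ)) : Finset (E × ℝ) :=
  L.filter fun l => ∃ v ∈ V, (inner ℝ l.1 v : ℝ) ≠ 0

open Classical in
/-- The positions, along `c + ℝ u`, of the zeros of the affine functions of `L` that are constant
in the directions of `V`. -/
def levels (V : Submodule ℝ E) (L : Finset (E × ℝ)) (c u : E) : Finset ℝ :=
  (L \ transverse V L).image fun l => -affineEval l c / inner ℝ l.1 u

/-- The closed half-space of `W` with inner normal `u`. -/
def halfSpace (W : Submodule ℝ E) (u : E) : Set E := {z | z ∈ W ∧ 0 ≤ (inner ℝ u z : ℝ)}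

/-- The points of `x + V` near which `G` is a translate of `D`. -/
def openFacet (V : Submodule ℝ E) (D G : Set E) (x : E) : Set E :=
  {y | y - x ∈ V ∧ ∀ᶠ z in 𝓝 y, (z ∈ G ↔ z - y ∈ D)}

/-- Immediately after `y` in the direction `u` one is in `G`. -/
def EntersAlong (u : E) (G : Set E) (y : E) : Prop := ∀ᶠ t in 𝓝[>] (0 : ℝ), y + t • u ∈ G

theorem tendsto_add_smul_nhdsGT (y u : E) :
    Tendsto (fun t : ℝ => y + t • u) (𝓝[>] 0) (𝓝 y) := by
  have : Continuous fun t : ℝ => y + t • u := by fun_prop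
  simpa using (this.tendsto 0).mono_left nhdsWithin_le_nhds

/-- Generic points are dense: a function that vanishes at a point becomes non-zero after a small
step in a direction of `V` in which it varies, and a small enough step keeps the earlier functions
non-zero. -/
theorem frequently_affineEval_ne_zero {V : Submodule ℝ E} (L : Finset (E × ℝ))
    (hL : ∀ l ∈ L, ∃ v ∈ V, (inner ℝ l.1 v : ℝ) ≠ 0) (y : E) :
    ∃ᶠ z in 𝓝 y, z - y ∈ V ∧ ∀ l ∈ L, affineEval l z ≠ 0 := by
  classical
  induction L using Finset.induction_on with
  | empty =>
    intro h
    exact h.self_of_nhds (by simp)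
  | insert l L hl ih =>
    have ih := ih fun l' hl' => hL l' (Finset.mem_insert_of_mem hl')
    intro h
    obtain ⟨z, ⟨hzV, hzL⟩, hz⟩ := (ih.and_eventually h.eventually_nhds).exists
    obtain ⟨v, hv, hlv⟩ := hL l (Finset.mem_insert_self _ _)
    by_cases hzl : affineEval l z = 0
    · have h1 := (tendsto_add_smul_nhdsGT z v).eventually hz
      have h2 : ∀ᶠ x in 𝓝 z, ∀ l ∈ L, affineEval l x ≠ 0 := by
        rw [Finset.eventually_all]
        exact fun l' hl' => (continuous_affineEval l').continuousAt.eventually_ne (hzL l' hl')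
      obtain ⟨t, h3, h4, h5⟩ := (h1.and (((tendsto_add_smul_nhdsGT z v).eventually h2).and
        self_mem_nhdsWithin)).exists
      refine h3 ⟨?_, ?_⟩
      · rw [add_sub_right_comm]
        exact V.add_mem hzV (V.smul_mem _ hv)
      · rw [Finset.forall_mem_insert]
        refine ⟨?_, h4⟩
        rw [affineEval_add, hzl, zero_add, inner_smul_right]
        exact mul_ne_zero (ne_of_gt h5) hlv
    · refine hz.self_of_nhds ⟨hzV, ?_⟩
      rw [Finset.forall_mem_insert]
      exact ⟨hzl, hzL⟩

theorem mem_transverse {V : Submodule ℝ E} {L : Finset (E × ℝ)} {l : E × ℝ} :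
    l ∈ transverse V L ↔ l ∈ L ∧ ∃ v ∈ V, (inner ℝ l.1 v : ℝ) ≠ 0 := by
  simp [transverse]

theorem inner_eq_zero_of_notMem_transverse {V : Submodule ℝ E} {L : Finset (E × ℝ)} {l : E × ℝ}
    (hl : l ∈ L) (h : l ∉ transverse V L) : ∀ v ∈ V, (inner ℝ l.1 v : ℝ) = 0 := by
  intro v hv
  by_contra h'
  exact h (mem_transverse.2 ⟨hl, v, hv, h'⟩)

theorem IsNormal.inner_of_orthogonal {V W : Submodule ℝ E} {u a z : E} (hu : IsNormal V W u)
    (ha : ∀ v ∈ V, (inner ℝ a v : ℝ) = 0) (hz : z ∈ W) :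
    (inner ℝ a z : ℝ) = inner ℝ u z * inner ℝ a u := by
  have h := ha _ ((hu.mem_iff z).1 hz)
  rw [inner_sub_right, inner_smul_right] at h
  linarith

namespace IsAdapted

variable {V W : Submodule ℝ E} {c u y z x : E} {L : Finset (E × ℝ)} {G : Set E}

theorem inner_normal_ne_zero (hG : IsAdapted W c L G) (hu : IsNormal V W u) {l : E × ℝ}
    (hl : l ∈ L) (h : l ∉ transverse V L) : (inner ℝ l.1 u : ℝ) ≠ 0 := by
  obtain ⟨w, hw, hlw⟩ := hG.nonconst l hl
  rw [hu.inner_of_orthogonal (inner_eq_zero_of_notMem_transverse hl h) hw] at hlw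
  exact right_ne_zero_of_mul hlw

/-- The functions vanishing at `y` are constant along `V`, so on `c + W` they are multiples of `⟨u,
z - y⟩`. Hence on the positive side of a small ball all signs agree with those along the ray from
`y`, and `G` contains all of that side or none of it. -/
theorem eventually_mem_iff_entersAlong (hG : IsAdapted W c L G) (hu : IsNormal V W u)
    (hy : y - c ∈ W) (hgen : ∀ l ∈ transverse V L, affineEval l y ≠ 0) :
    ∀ᶠ z in 𝓝 y, z - c ∈ W → 0 < (inner ℝ u (z - y) : ℝ) → (z ∈ G ↔ EntersAlong u G y) := by
  have key : ∀ l ∈ L, ∀ᶠ z in 𝓝 y, z - c ∈ W → 0 < (inner ℝ u (z - y) : ℝ) →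
      ∀ᶠ t in 𝓝[>] (0 : ℝ), 0 < affineEval l z * affineEval l (y + t • u) := by
    intro l hl
    by_cases h0 : affineEval l y = 0
    · have ht : l ∉ transverse V L := fun h => hgen l h h0
      have hlu := hG.inner_normal_ne_zero hu hl ht
      refine Eventually.of_forall fun z hz hpos => ?_
      filter_upwards [self_mem_nhdsWithin] with t (ht' : 0 < t)
      have hzy : z - y ∈ W := by
        have := W.sub_mem hz hy
        simpa using this
      rw [affineEval_eq_add_inner_sub l y z, h0, affineEval_add, h0,
        hu.inner_of_orthogonal (inner_eq_zero_of_notMem_transverse hl ht) hzy, inner_smul_right]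
      have : 0 < (inner ℝ l.1 u : ℝ) ^ 2 := by positivity
      have e : (0 + inner ℝ u (z - y) * inner ℝ l.1 u) * (0 + t * inner ℝ l.1 u) =
        inner ℝ u (z - y) * t * (inner ℝ l.1 u : ℝ) ^ 2 := by ring
      rw [e]
      positivity
    · have h1 : ∀ᶠ z in 𝓝 y, 0 < affineEval l z * affineEval l y := by
        have : Continuous fun z => affineEval l z * affineEval l y :=
          (continuous_affineEval l).mul continuous_const
        exact this.continuousAt.eventually_const_lt (mul_self_pos.2 h0)
      filter_upwards [h1] with z hz _ _
      have : Continuous fun x => affineEval l z * affineEval l x :=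
        continuous_const.mul (continuous_affineEval l)
      exact (tendsto_add_smul_nhdsGT y u).eventually (this.continuousAt.eventually_const_lt hz)
  filter_upwards [(Finset.eventually_all L).2 key] with z hz hzc hzy
  have h := (Finset.eventually_all L).2 fun l hl => hz l hl hzc hzy
  have hiff : ∀ᶠ t in 𝓝[>] (0 : ℝ), (z ∈ G ↔ y + t • u ∈ G) := by
    filter_upwards [h] with t ht
    refine hG.mem_congr z _ hzc ?_ ht
    rw [add_sub_right_comm]
    exact W.add_mem hy (W.smul_mem _ hu.mem)
  constructor
  · intro hzG
    filter_upwards [hiff] with t ht using ht.1 hzG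
  · intro hE
    obtain ⟨t, h1, h2⟩ := (hiff.and hE).exists
    exact h1.2 h2

/-- Every function has a constant sign on a short initial piece of the ray, so a ray that does not
enter `G` stays outside at first. The genericity asked for concerns the line only: functions that
vary in the direction `u` may vanish at `y`. -/
theorem eventually_add_smul_mem_iff (hG : IsAdapted W c L G) (hu : u ∈ W)
    (hy : y - c ∈ W) (hline : ∀ l ∈ L, (inner ℝ l.1 u : ℝ) = 0 → affineEval l y ≠ 0) :
    ∀ᶠ t in 𝓝[>] (0 : ℝ), (y + t • u ∈ G ↔ EntersAlong u G y) := by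
  -- `s` carries the sign of `l` just after `y`: its slope if it vanishes at `y`, its value
  -- otherwise.
  have key : ∀ l ∈ L, ∃ s : ℝ, ∀ᶠ t in 𝓝[>] (0 : ℝ), 0 < affineEval l (y + t • u) * s := by
    intro l hl
    by_cases h0 : affineEval l y = 0
    · refine ⟨inner ℝ l.1 u, ?_⟩
      have hlu : (inner ℝ l.1 u : ℝ) ≠ 0 := fun h => hline l hl h h0
      filter_upwards [self_mem_nhdsWithin] with t (ht : 0 < t)
      rw [affineEval_add, h0, inner_smul_right, zero_add, mul_assoc]
      exact mul_pos ht (mul_self_pos.2 hlu)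
    · refine ⟨affineEval l y, ?_⟩
      have : Continuous fun x => affineEval l x * affineEval l y :=
        (continuous_affineEval l).mul continuous_const
      exact (tendsto_add_smul_nhdsGT y u).eventually
        (this.continuousAt.eventually_const_lt (mul_self_pos.2 h0))
  choose! s hs using key
  have hs := (Finset.eventually_all L).2 hs
  by_cases hE : EntersAlong u G y
  · filter_upwards [hE] with t ht using iff_of_true ht hE
  · filter_upwards [hs] with t ht
    refine iff_of_false (fun htG => hE ?_) hE
    filter_upwards [hs] with r hr
    have hW : ∀ a : ℝ, y + a • u - c ∈ W := fun a => by
      rw [add_sub_right_comm]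
      exact W.add_mem hy (W.smul_mem _ hu)
    refine (hG.mem_congr _ _ (hW t) (hW r) fun l hl => ?_).1 htG
    have := mul_pos (ht l hl) (hr l hl)
    have h2 : 0 < s l ^ 2 := by
      have : s l ≠ 0 := right_ne_zero_of_mul (ht l hl).ne'
      positivity
    rw [show affineEval l (y + t • u) * s l * (affineEval l (y + r • u) * s l) =
      affineEval l (y + t • u) * affineEval l (y + r • u) * s l ^ 2 by ring] at this
    exact pos_of_mul_pos_left this h2.le

theorem eventually_entersAlong_iff (hG : IsAdapted W c L G) (hu : IsNormal V W u)
    (hy : y - c ∈ W) (hgen : ∀ l ∈ transverse V L, affineEval l y ≠ 0) :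
    ∀ᶠ z in 𝓝 y, z - y ∈ V → (EntersAlong u G z ↔ EntersAlong u G y) := by
  filter_upwards [(hG.eventually_mem_iff_entersAlong hu hy hgen).eventually_nhds] with z hz hzy
  have h : ∀ᶠ t in 𝓝[>] (0 : ℝ), (z + t • u ∈ G ↔ EntersAlong u G y) := by
    filter_upwards [(tendsto_add_smul_nhdsGT z u).eventually hz, self_mem_nhdsWithin]
      with t ht (ht0 : 0 < t)
    refine ht ?_ ?_
    · have : z + t • u - c = (z - y) + (y - c) + t • u := by abel
      rw [this]
      exact W.add_mem (W.add_mem (hu.le hzy) hy) (W.smul_mem _ hu.mem)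
    · rw [add_sub_right_comm, hu.inner_add_smul hzy]
      exact ht0
  constructor
  · intro h1
    obtain ⟨t, h2, h3⟩ := (h.and h1).exists
    exact h2.1 h3
  · intro h1
    filter_upwards [h] with t ht using ht.2 h1

/-- Functions constant along `V` take equal values at `y + t u` and `z + t u`, so only the signs of
the transverse functions can distinguish the two rays. This makes the facets adapted to the
transverse functions alone. -/
theorem entersAlong_of_forall_pos (hG : IsAdapted W c L G) (hu : IsNormal V W u)
    (hy : y - c ∈ W) (hzy : z - y ∈ V)
    (hsign : ∀ l ∈ transverse V L, 0 < affineEval l y * affineEval l z)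
    (h : EntersAlong u G y) : EntersAlong u G z := by
  have key : ∀ l ∈ L, ∀ᶠ t in 𝓝[>] (0 : ℝ),
      0 < affineEval l (y + t • u) * affineEval l (z + t • u) := by
    intro l hl
    by_cases ht : l ∈ transverse V L
    · have : Continuous fun t : ℝ => affineEval l (y + t • u) * affineEval l (z + t • u) := by
        unfold affineEval; fun_prop
      have h0 := (this.tendsto 0).mono_left (nhdsWithin_le_nhds (s := Set.Ioi 0))
      simp only [zero_smul, add_zero] at h0
      exact h0.eventually_const_lt (hsign l ht)
    · have h1 : affineEval l z = affineEval l y := by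
        rw [affineEval_eq_add_inner_sub l y z, inner_eq_zero_of_notMem_transverse hl ht _ hzy,
          add_zero]
      have hlu := hG.inner_normal_ne_zero hu hl ht
      simp only [affineEval_add, h1, inner_smul_right]
      have h2 : ∀ᶠ t in 𝓝[>] (0 : ℝ), affineEval l y + t * inner ℝ l.1 u ≠ 0 := by
        by_cases h0 : affineEval l y = 0
        · filter_upwards [self_mem_nhdsWithin] with t (ht : 0 < t)
          rw [h0, zero_add]
          positivity
        · have : Continuous fun t : ℝ => affineEval l y + t * inner ℝ l.1 u := by fun_prop
          have h0' := (this.tendsto 0).mono_left (nhdsWithin_le_nhds (s := Set.Ioi 0))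
          simp only [zero_mul, add_zero] at h0'
          exact h0'.eventually_ne h0
      filter_upwards [h2] with t ht using mul_self_pos.2 ht
  filter_upwards [(Finset.eventually_all L).2 key, h] with t ht htG
  have hyt : y + t • u - c ∈ W := by
    rw [add_sub_right_comm]
    exact W.add_mem hy (W.smul_mem _ hu.mem)
  refine (hG.mem_congr _ _ hyt ?_ ht).1 htG
  have : z + t • u - c = (z - y) + (y + t • u - c) := by abel
  rw [this]
  exact W.add_mem (hu.le hzy) hyt

/-- Near a generic point each open side of `y + V` is filled by `G` or free of it; if the positive
side is filled, closedness of `G` adds the points of `y + V` itself. -/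
theorem mem_openFacet_iff (hG : IsAdapted W c L G) (hu : IsNormal V W u)
    (hy : y - c ∈ W) (hgen : ∀ l ∈ transverse V L, affineEval l y ≠ 0) :
    y ∈ openFacet V (halfSpace W u) G x ↔
      y - x ∈ V ∧ EntersAlong u G y ∧ ¬ EntersAlong (-u) G y := by
  refine and_congr_right fun _ => ⟨fun h => ⟨?_, fun h' => ?_⟩, fun ⟨h1, h2⟩ => ?_⟩
  · filter_upwards [(tendsto_add_smul_nhdsGT y u).eventually h, self_mem_nhdsWithin]
      with t ht (ht0 : 0 < t)
    refine ht.2 ⟨?_, ?_⟩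
    · simpa using W.smul_mem t hu.mem
    · rw [add_sub_cancel_left, inner_smul_right, hu.inner_self]
      simpa using ht0.le
  · obtain ⟨t, h1, h2, h3⟩ := (h'.and (((tendsto_add_smul_nhdsGT y (-u)).eventually h).and
      self_mem_nhdsWithin)).exists
    have h4 := (h2.1 h1).2
    rw [add_sub_cancel_left, inner_smul_right, inner_neg_right, hu.inner_self] at h4
    have h5 : 0 < t := h3
    linarith
  · have ep := hG.eventually_mem_iff_entersAlong hu hy hgen
    have en := hG.eventually_mem_iff_entersAlong hu.neg hy hgen
    filter_upwards [ep, ep.eventually_nhds, en] with z hp hp' hn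
    by_cases hzc : z - c ∈ W
    · have hzy : z - y ∈ W := by simpa using W.sub_mem hzc hy
      rcases lt_trichotomy (inner ℝ u (z - y) : ℝ) 0 with h | h | h
      · have := hn hzc (by rw [inner_neg_left]; linarith)
        refine iff_of_false (fun hz => h2 (this.1 hz)) fun hz => ?_
        linarith [hz.2]
      · refine iff_of_true ?_ ⟨hzy, h.ge⟩
        refine hG.isClosed.mem_of_tendsto (tendsto_add_smul_nhdsGT z u) ?_
        filter_upwards [(tendsto_add_smul_nhdsGT z u).eventually hp', self_mem_nhdsWithin]
          with t ht (ht0 : 0 < t)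
        refine (ht ?_ ?_).2 h1
        · rw [add_sub_right_comm]
          exact W.add_mem hzc (W.smul_mem _ hu.mem)
        · rw [add_sub_right_comm, inner_add_right, h, inner_smul_right, hu.inner_self]
          simpa using ht0
      · exact iff_of_true ((hp hzc h).2 h1) ⟨hzy, h.le⟩
    · refine iff_of_false (fun hz => hzc (hG.sub_mem z hz)) fun hz => hzc ?_
      simpa using W.add_mem hz.1 hy

/-- Near a generic point, entering along `u` or `-u` does not change under small moves in `V`, so
the closure adds no generic points. -/
theorem mem_closure_openFacet_iff (hG : IsAdapted W c L G) (hu : IsNormal V W u)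
    (hy : y - c ∈ W) (hgen : ∀ l ∈ transverse V L, affineEval l y ≠ 0) (hyx : y - x ∈ V) :
    y ∈ closure (openFacet V (halfSpace W u) G x) ↔
      EntersAlong u G y ∧ ¬ EntersAlong (-u) G y := by
  refine ⟨fun h => ?_, fun h => _root_.subset_closure ((hG.mem_openFacet_iff hu hy hgen).2 ⟨hyx, h⟩)⟩
  have hgen' : ∀ᶠ z in 𝓝 y, ∀ l ∈ transverse V L, affineEval l z ≠ 0 := by
    rw [Finset.eventually_all]
    exact fun l hl => (continuous_affineEval l).continuousAt.eventually_ne (hgen l hl)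
  obtain ⟨z, hz, hzg, hzp, hzn⟩ := ((mem_closure_iff_frequently.1 h).and_eventually
    (hgen'.and ((hG.eventually_entersAlong_iff hu hy hgen).and
      (hG.eventually_entersAlong_iff hu.neg hy hgen)))).exists
  have hzy : z - y ∈ V := by simpa using V.sub_mem hz.1 hyx
  have hzc : z - c ∈ W := by simpa using W.add_mem (hu.le hzy) hy
  rw [← hzp hzy, ← hzn hzy]
  exact ((hG.mem_openFacet_iff hu hzc hzg).1 hz).2

end IsAdapted

variable {V W : Submodule ℝ E} {c u y z x : E} {L : Finset (E × ℝ)} {G D : Set E}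

theorem eventually_mem_openFacet (hD : ∀ z, ∀ v ∈ V, z + v ∈ D ↔ z ∈ D)
    (hy : y ∈ openFacet V D G x) : ∀ᶠ z in 𝓝 y, z - y ∈ V → z ∈ openFacet V D G x := by
  filter_upwards [hy.2.eventually_nhds] with z hz hzy
  refine ⟨by simpa using V.add_mem hzy hy.1, ?_⟩
  filter_upwards [hz] with w hw
  rw [hw, ← hD (w - z) _ hzy]
  simp

theorem add_mem_halfSpace_iff (hu : IsNormal V W u) (z v : E) (hv : v ∈ V) :
    z + v ∈ halfSpace W u ↔ z ∈ halfSpace W u := by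
  unfold halfSpace
  simp only [Set.mem_ofPred_eq, inner_add_right, hu.inner_eq v hv, add_zero,
    W.add_mem_iff_left (hu.le hv)]

theorem openFacet_congr (h : x - y ∈ V) : openFacet V D G x = openFacet V D G y := by
  ext z
  refine and_congr_left fun _ => ⟨fun hz => ?_, fun hz => ?_⟩
  · simpa using V.add_mem hz h
  · simpa using V.sub_mem hz h

theorem sub_mem_of_mem_closure_openFacet [FiniteDimensional ℝ E]
    (hy : y ∈ closure (openFacet V D G x)) : y - x ∈ V := by
  have hc : IsClosed {y | y - x ∈ V} :=
    V.closed_of_finiteDimensional.preimage (continuous_id.sub continuous_const)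
  exact closure_minimal (fun z hz => hz.1) hc hy

theorem closure_openFacet_subset (h0 : (0 : E) ∈ D) (hG : IsClosed G) :
    closure (openFacet V D G x) ⊆ G :=
  closure_minimal (fun z hz => hz.2.self_of_nhds.2 (by simpa using h0)) hG

theorem zero_mem_halfSpace : (0 : E) ∈ halfSpace W u := ⟨W.zero_mem, by simp⟩

/-- The generic points of a facet are dense in it. -/
theorem closure_openFacet_subset_closure (hu : IsNormal V W u) :
    closure (openFacet V (halfSpace W u) G x) ⊆
      closure {y | y ∈ openFacet V (halfSpace W u) G x ∧
        ∀ l ∈ transverse V L, affineEval l y ≠ 0} := by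
  refine closure_minimal (fun y hy => ?_) isClosed_closure
  rw [mem_closure_iff_frequently]
  have h := frequently_affineEval_ne_zero (V := V) (transverse V L)
    (fun l hl => (mem_transverse.1 hl).2) y
  exact (h.and_eventually (eventually_mem_openFacet (add_mem_halfSpace_iff hu) hy)).mono
    fun z hz => ⟨hz.2 hz.1.1, hz.1.2⟩

/-- This is what makes the induction along the flag possible. At generic points, membership in the
facet amounts to entering along `u` and not along `-u`, which the signs of the transverse functions
decide. -/
theorem IsAdapted.closure_openFacet [FiniteDimensional ℝ E] (hG : IsAdapted W c L G)
    (hu : IsNormal V W u) (hx : x - c ∈ W) :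
    IsAdapted V x (transverse V L) (closure (openFacet V (halfSpace W u) G x)) where
  isClosed := isClosed_closure
  isBounded := hG.isBounded.subset (closure_openFacet_subset zero_mem_halfSpace hG.isClosed)
  sub_mem y hy := sub_mem_of_mem_closure_openFacet hy
  nonconst l hl := (mem_transverse.1 hl).2
  mem_congr := by
    have key : ∀ y z, y - x ∈ V → z - x ∈ V →
        (∀ l ∈ transverse V L, 0 < affineEval l y * affineEval l z) →
        y ∈ closure (openFacet V (halfSpace W u) G x) →
        z ∈ closure (openFacet V (halfSpace W u) G x) := by
      intro y z hy hz hs h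
      have hyc : y - c ∈ W := by simpa using W.add_mem (hu.le hy) hx
      have hzc : z - c ∈ W := by simpa using W.add_mem (hu.le hz) hx
      have hzy : z - y ∈ V := by simpa using V.sub_mem hz hy
      have hyz : y - z ∈ V := by simpa using V.sub_mem hy hz
      rw [hG.mem_closure_openFacet_iff hu hyc
        (fun l hl => left_ne_zero_of_mul (hs l hl).ne') hy] at h
      rw [hG.mem_closure_openFacet_iff hu hzc
        (fun l hl => right_ne_zero_of_mul (hs l hl).ne') hz]
      refine ⟨hG.entersAlong_of_forall_pos hu hyc hzy hs h.1, fun h' => h.2 ?_⟩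
      exact hG.entersAlong_of_forall_pos hu.neg hzc hyz
        (fun l hl => by rw [mul_comm]; exact hs l hl) h'
    exact fun y z hy hz hs => ⟨key y z hy hz hs,
      key z y hz hy fun l hl => by rw [mul_comm]; exact hs l hl⟩
  subset_closure := (closure_openFacet_subset_closure hu).trans
    (closure_mono fun y hy => ⟨_root_.subset_closure hy.1, hy.2⟩)

/-- Facets parallel to `V` occur only at the levels of the affine functions constant along `V`. -/
theorem IsAdapted.mem_levels_of_nonempty (hG : IsAdapted W c L G) (hu : IsNormal V W u) {t : ℝ}
    (h : (openFacet V (halfSpace W u) G (c + t • u)).Nonempty) : t ∈ levels V L c u := by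
  by_contra ht
  obtain ⟨y₀, hy₀⟩ := closure_nonempty_iff.1
    ((closure_nonempty_iff.2 h).mono (closure_openFacet_subset_closure (L := L) hu))
  obtain ⟨hy, hgen⟩ := hy₀
  have hyc : y₀ - c ∈ W := by
    have : y₀ - c = (y₀ - (c + t • u)) + t • u := by abel
    rw [this]
    exact hu.add_smul_mem hy.1 t
  obtain ⟨-, h1, h2⟩ := (hG.mem_openFacet_iff hu hyc hgen).1 hy
  -- Away from the levels no function vanishes at the generic facet point `y₀`. Then `G` contains
  -- all points of `c + W` near `y₀`, including those in the direction `-u`, a contradiction.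
  have hne : ∀ l ∈ L, affineEval l y₀ ≠ 0 := by
    intro l hl h0
    have hlt : l ∉ transverse V L := fun h => hgen l h h0
    have hlu := hG.inner_normal_ne_zero hu hl hlt
    apply ht
    simp only [levels, Finset.mem_image, Finset.mem_sdiff]
    refine ⟨l, ⟨hl, hlt⟩, ?_⟩
    rw [div_eq_iff hlu]
    have : y₀ = c + t • u + (y₀ - (c + t • u)) := by abel
    rw [this, affineEval_add, affineEval_add,
      inner_eq_zero_of_notMem_transverse hl hlt _ hy.1, inner_smul_right] at h0
    linarith
  apply h2
  have key : ∀ᶠ z in 𝓝 y₀, ∀ l ∈ L, 0 < affineEval l y₀ * affineEval l z := by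
    rw [Finset.eventually_all]
    intro l hl
    have : Continuous fun z => affineEval l y₀ * affineEval l z :=
      continuous_const.mul (continuous_affineEval l)
    exact this.continuousAt.eventually_const_lt (mul_self_pos.2 (hne l hl))
  have hyG : y₀ ∈ G := hy.2.self_of_nhds.2 (by simpa using zero_mem_halfSpace)
  filter_upwards [(tendsto_add_smul_nhdsGT y₀ (-u)).eventually key] with s hs
  refine (hG.mem_congr _ _ hyc ?_ hs).1 hyG
  rw [add_sub_right_comm]
  exact W.add_mem hyc (W.smul_mem _ hu.neg.mem)

end Local

/-! ### Signed sums over the facets parallel to a hyperplane -/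

section FacetSum

theorem neg_mem_levels_iff {E : Type*} [NormedAddCommGroup E] [InnerProductSpace ℝ E]
    {V : Submodule ℝ E} {L : Finset (E × ℝ)} {c u : E} {t : ℝ} :
    -t ∈ levels V L c (-u) ↔ t ∈ levels V L c u := by
  simp only [levels, Finset.mem_image, inner_neg_right, div_neg, neg_inj]

variable {d : ℕ}

variable {V W : Submodule ℝ (EuclideanSpace ℝ (Fin d))} {c u : EuclideanSpace ℝ (Fin d)}
  {L : Finset (EuclideanSpace ℝ (Fin d) × ℝ)} {G F : Set (EuclideanSpace ℝ (Fin d))}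

theorem inner_sub_of_mem_closure_openFacet (hu : IsNormal V W u)
    {D : Set (EuclideanSpace ℝ (Fin d))} {t : ℝ} {y : EuclideanSpace ℝ (Fin d)}
    (hy : y ∈ closure (openFacet V D G (c + t • u))) : (inner ℝ u (y - c) : ℝ) = t := by
  have : y - c = (y - (c + t • u)) + t • u := by abel
  rw [this, hu.inner_add_smul (sub_mem_of_mem_closure_openFacet hy)]

/-- A translate of `V` meeting `c + W` is `c + t u + V` with `t` read off from the inner product
with `u`; only finitely many levels `t` can carry a facet. -/
theorem isFacet_halfSpace_iff (hG : IsAdapted W c L G) (hu : IsNormal V W u) :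
    IsFacet V (halfSpace W u) G F ↔ F.Nonempty ∧ ∃ t ∈ levels V L c u,
      closure (openFacet V (halfSpace W u) G (c + t • u)) = F := by
  refine and_congr_right fun hF => ⟨?_, ?_⟩
  · rintro ⟨x, hFx⟩
    change F = closure (openFacet V (halfSpace W u) G x) at hFx
    obtain ⟨y, hy⟩ := closure_nonempty_iff.1 (hFx ▸ hF)
    have hyG : y ∈ G := hy.2.self_of_nhds.2 (by simpa using zero_mem_halfSpace)
    have hyc := hG.sub_mem y hyG
    have hx : x - (c + (inner ℝ u (y - c) : ℝ) • u) ∈ V := by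
      have := V.sub_mem ((hu.mem_iff _).1 hyc) hy.1
      convert this using 1
      abel
    rw [openFacet_congr hx] at hFx
    refine ⟨_, hG.mem_levels_of_nonempty hu ?_, hFx.symm⟩
    exact closure_nonempty_iff.1 (hFx ▸ hF)
  · rintro ⟨t, -, rfl⟩
    exact ⟨_, rfl⟩

theorem isFacet_halfSpace_neg_iff (hG : IsAdapted W c L G) (hu : IsNormal V W u) :
    IsFacet V (halfSpace W (-u)) G F ↔ F.Nonempty ∧ ∃ t ∈ levels V L c u,
      closure (openFacet V (halfSpace W (-u)) G (c + t • u)) = F := by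
  rw [isFacet_halfSpace_iff hG hu.neg]
  refine and_congr_right fun _ => ⟨?_, ?_⟩
  · rintro ⟨t, ht, h⟩
    refine ⟨-t, ?_, by rwa [neg_smul, ← smul_neg]⟩
    rwa [← neg_mem_levels_iff, neg_neg]
  · rintro ⟨t, ht, h⟩
    exact ⟨-t, neg_mem_levels_iff.2 ht, by rwa [neg_smul_neg]⟩

/-- At a generic point the two sides impose contradictory entering conditions. Hence the sign, which
tests the positive side only, is unambiguous. -/
theorem not_isFacet_halfSpace_neg (hG : IsAdapted W c L G) (hu : IsNormal V W u)
    (hp : IsFacet V (halfSpace W u) G F) : ¬ IsFacet V (halfSpace W (-u)) G F := by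
  intro hn
  obtain ⟨⟨y, hy⟩, t, ht, rfl⟩ := (isFacet_halfSpace_iff hG hu).1 hp
  obtain ⟨-, s, hs, hst⟩ := (isFacet_halfSpace_neg_iff hG hu).1 hn
  have hts : t = s := by
    rw [← inner_sub_of_mem_closure_openFacet hu hy]
    rw [← hst] at hy
    exact inner_sub_of_mem_closure_openFacet hu hy
  subst hts
  obtain ⟨z, hz, hzg⟩ := closure_nonempty_iff.1
    (⟨y, closure_openFacet_subset_closure (L := L) hu hy⟩ : (closure _).Nonempty)
  have hzG : z ∈ G := hz.2.self_of_nhds.2 (by simpa using zero_mem_halfSpace)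
  have hzc := hG.sub_mem z hzG
  have h1 := (hG.mem_openFacet_iff hu hzc hzg).1 hz
  have h2 := subset_closure hz
  rw [← hst, hG.mem_closure_openFacet_iff hu.neg hzc hzg hz.1] at h2
  exact h1.2.2 h2.1

theorem finite_setOf_isFacet (hG : IsAdapted W c L G) (hu : IsNormal V W u) :
    {F | IsFacet V (halfSpace W u) G F ∨ IsFacet V (halfSpace W (-u)) G F}.Finite := by
  refine (((levels V L c u).finite_toSet.image fun t =>
    closure (openFacet V (halfSpace W u) G (c + t • u))).union
    ((levels V L c u).finite_toSet.image fun t =>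
    closure (openFacet V (halfSpace W (-u)) G (c + t • u)))).subset ?_
  rintro F (hF | hF)
  · obtain ⟨-, t, ht, h⟩ := (isFacet_halfSpace_iff hG hu).1 hF
    exact Or.inl ⟨t, ht, h⟩
  · obtain ⟨-, t, ht, h⟩ := (isFacet_halfSpace_neg_iff hG hu).1 hF
    exact Or.inr ⟨t, ht, h⟩

/-- Nonempty facets at different levels are different sets, and levels without a facet contribute `φ
∅ = 0`. -/
theorem finsum_mem_isFacet_halfSpace {D : Set (EuclideanSpace ℝ (Fin d))} (hu : IsNormal V W u)
    (hD : ∀ F, IsFacet V D G F ↔ F.Nonempty ∧ ∃ t ∈ levels V L c u,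
      closure (openFacet V D G (c + t • u)) = F)
    (φ : Set (EuclideanSpace ℝ (Fin d)) → ℂ) (h0 : φ ∅ = 0) :
    ∑ᶠ F ∈ {F | IsFacet V D G F}, φ F =
      ∑ t ∈ levels V L c u, φ (closure (openFacet V D G (c + t • u))) := by
  classical
  have e : {F | IsFacet V D G F} = (fun t => closure (openFacet V D G (c + t • u))) ''
      (((levels V L c u).filter fun t => (closure (openFacet V D G (c + t • u))).Nonempty :
        Finset ℝ) : Set ℝ) := by
    ext F
    simp only [Set.mem_ofPred_eq, hD, Set.mem_image, Finset.coe_filter]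
    constructor
    · rintro ⟨hF, t, ht, rfl⟩
      exact ⟨t, ⟨ht, hF⟩, rfl⟩
    · rintro ⟨t, ⟨ht, hF⟩, rfl⟩
      exact ⟨hF, t, ht, rfl⟩
  rw [e, finsum_mem_image, finsum_mem_coe_finset, Finset.sum_filter_of_ne]
  · intro t _ h
    rw [Set.nonempty_iff_ne_empty]
    exact fun h' => h (h' ▸ h0)
  · intro t ht s hs hts
    rw [Finset.coe_filter] at ht
    obtain ⟨y, hy⟩ := ht.2
    rw [← inner_sub_of_mem_closure_openFacet hu hy]
    simp only at hts
    rw [hts] at hy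
    exact inner_sub_of_mem_closure_openFacet hu hy

open Classical in
theorem finsum_mem_facets (hG : IsAdapted W c L G) (hu : IsNormal V W u)
    (φ : Set (EuclideanSpace ℝ (Fin d)) → ℂ) (h0 : φ ∅ = 0) :
    ∑ᶠ F ∈ {F | IsFacet V (halfSpace W u) G F ∨ IsFacet V (halfSpace W (-u)) G F},
      (if IsFacet V (halfSpace W u) G F then 1 else -1) * φ F =
      ∑ t ∈ levels V L c u, (φ (closure (openFacet V (halfSpace W u) G (c + t • u))) -
        φ (closure (openFacet V (halfSpace W (-u)) G (c + t • u)))) := by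
  have hfin := finite_setOf_isFacet hG hu
  rw [Finset.sum_sub_distrib,
    ← finsum_mem_isFacet_halfSpace hu (fun F => isFacet_halfSpace_iff hG hu) φ h0,
    ← finsum_mem_isFacet_halfSpace hu (fun F => isFacet_halfSpace_neg_iff hG hu) φ h0]
  have e : {F | IsFacet V (halfSpace W u) G F ∨ IsFacet V (halfSpace W (-u)) G F} =
    {F | IsFacet V (halfSpace W u) G F} ∪ {F | IsFacet V (halfSpace W (-u)) G F} := rfl
  rw [e] at hfin ⊢
  rw [finsum_mem_union _ (hfin.subset Set.subset_union_left)
    (hfin.subset Set.subset_union_right), sub_eq_add_neg]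
  · congr 1
    · refine finsum_mem_congr rfl fun F hF => ?_
      have hF' : IsFacet V (halfSpace W u) G F := hF
      rw [if_pos hF', one_mul]
    · rw [← finsum_mem_neg_distrib _ (hfin.subset Set.subset_union_right)]
      refine finsum_mem_congr rfl fun F hF => ?_
      rw [if_neg fun h => not_isFacet_halfSpace_neg hG hu h hF, neg_one_mul]
  · rw [Set.disjoint_left]
    exact fun F h => not_isFacet_halfSpace_neg hG hu h

end FacetSum

/-! ### Null sets and the Riemann–Lebesgue lemma -/

section Null

variable {F : Type*} [NormedAddCommGroup F] [InnerProductSpace ℝ F] [FiniteDimensional ℝ F]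
  [MeasurableSpace F] [BorelSpace F]

theorem ae_inner_add_ne_zero (a : F) (b : ℝ) (h : a ≠ 0 ∨ b ≠ 0) :
    ∀ᵐ v : F, (inner ℝ a v : ℝ) + b ≠ 0 := by
  by_cases ha : a = 0
  · have hb : b ≠ 0 := h.resolve_left (not_not.2 ha)
    simp [ha, hb]
  · let S : AffineSubspace ℝ F :=
      AffineSubspace.comap ((innerₛₗ ℝ a).toAffineMap + AffineMap.const ℝ F b)
        (AffineSubspace.mk' (0 : ℝ) ⊥)
    have hS : ∀ v, v ∈ S ↔ (inner ℝ a v : ℝ) + b = 0 := fun v => by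
      simp [S, AffineSubspace.mem_comap, AffineSubspace.mem_mk']
    have hS' : S ≠ ⊤ := by
      intro h
      have h1 : (0 : F) ∈ S := h ▸ AffineSubspace.mem_top ℝ F 0
      have h2 : a ∈ S := h ▸ AffineSubspace.mem_top ℝ F a
      rw [hS] at h1 h2
      simp only [inner_zero_right, zero_add] at h1
      rw [h1, add_zero, inner_self_eq_zero] at h2
      exact ha h2
    rw [ae_iff]
    convert Measure.addHaar_affineSubspace (volume : Measure F) S hS' using 2
    ext v
    simp [hS]

theorem exists_norm_integral_mul_exp_le (g : F → ℂ) {ε : ℝ} (hε : 0 < ε) :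
    ∃ R : ℝ, ∀ w : F, R ≤ ‖w‖ →
      ‖∫ v, g v * Complex.exp (2 * Real.pi * Complex.I * ((inner ℝ w v : ℝ) : ℂ))‖ ≤ ε := by
  have h := tendsto_integral_exp_inner_smul_cocompact g
  rw [← Metric.cobounded_eq_cocompact] at h
  have h2 := Metric.tendsto_nhds.1 h ε hε
  rw [(Filter.atTop_basis.cobounded_of_norm (E := F)).eventually_iff] at h2
  obtain ⟨R, -, hR⟩ := h2
  refine ⟨R, fun w hw => ?_⟩
  have := hR (x := -w) (by simpa using hw)
  rw [dist_zero_right] at this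
  refine le_of_eq_of_le ?_ this.le
  congr 2
  ext v
  rw [Circle.smul_def, Real.fourierChar_apply, smul_eq_mul, mul_comm (g v)]
  congr 2
  rw [inner_neg_right, neg_neg, real_inner_comm]
  push_cast
  ring

end Null

/-! ### Fourier integrals of pieces, and jumps along generic lines -/

section Piece

variable {d : ℕ}

/-- The Fourier integral of `G` with respect to `k`-dimensional volume. -/
def pieceIntegral (k : ℕ) (G : Set (EuclideanSpace ℝ (Fin d))) (ξ : EuclideanSpace ℝ (Fin d)) :
    ℂ :=
  ∫ x in G, expo ξ x ∂(Measure.euclideanHausdorffMeasure k)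

theorem pieceIntegral_empty (k : ℕ) (ξ : EuclideanSpace ℝ (Fin d)) :
    pieceIntegral k ∅ ξ = 0 := by
  simp [pieceIntegral]

theorem continuous_expo (ξ : EuclideanSpace ℝ (Fin d)) : Continuous (expo ξ) := by
  unfold expo; fun_prop

theorem norm_expo (ξ x : EuclideanSpace ℝ (Fin d)) : ‖expo ξ x‖ = 1 := by
  have : expo ξ x = Complex.exp (((2 * Real.pi * inner ℝ ξ x : ℝ) : ℂ) * Complex.I) := by
    unfold expo
    congr 1
    push_cast
    ring
  rw [this, Complex.norm_exp_ofReal_mul_I]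

theorem expo_add (ξ x y : EuclideanSpace ℝ (Fin d)) :
    expo ξ (x + y) = expo ξ x * expo ξ y := by
  rw [expo, inner_add_right, Complex.ofReal_add, mul_add, Complex.exp_add, expo, expo]

variable {V W : Submodule ℝ (EuclideanSpace ℝ (Fin d))} {c u : EuclideanSpace ℝ (Fin d)}
  {L : Finset (EuclideanSpace ℝ (Fin d) × ℝ)} {G F : Set (EuclideanSpace ℝ (Fin d))}

theorem isometry_add_coe (c : EuclideanSpace ℝ (Fin d)) :
    Isometry (fun v : V => c + (v : EuclideanSpace ℝ (Fin d))) :=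
  Isometry.of_dist_eq fun x y => by rw [dist_add_left]; rfl

theorem measurableEmbedding_add_coe (c : EuclideanSpace ℝ (Fin d)) :
    MeasurableEmbedding (fun v : V => c + (v : EuclideanSpace ℝ (Fin d))) :=
  (isometry_add_coe c).isClosedEmbedding.measurableEmbedding

/-- Integrals over subsets of `c + V` against the Hausdorff measure, in the coordinate `v ∈ V`. -/
theorem setIntegral_euclideanHausdorffMeasure {k : ℕ} (hk : Module.finrank ℝ V = k)
    (hG : MeasurableSet G) (hGV : ∀ y ∈ G, y - c ∈ V) (f : EuclideanSpace ℝ (Fin d) → ℂ) :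
    ∫ x in G, f x ∂(Measure.euclideanHausdorffMeasure k) =
      ∫ v : V, G.indicator f (c + v) := by
  have h1 := (isometry_add_coe (V := V) c).map_euclideanHausdorffMeasure (d := k)
  have h2 : (Measure.euclideanHausdorffMeasure k : Measure V) = volume := by
    subst hk
    exact InnerProductSpace.euclideanHausdorffMeasure_eq_volume
  rw [h2] at h1
  rw [← (measurableEmbedding_add_coe c).integral_map (G.indicator f), h1, integral_indicator hG,
    Measure.restrict_restrict hG, Set.inter_eq_left.2]
  intro y hy
  exact ⟨⟨y - c, hGV y hy⟩, by simp⟩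

theorem integrable_of_norm_le_of_bounded {F : Type*} [NormedAddCommGroup F] [InnerProductSpace ℝ F]
    [FiniteDimensional ℝ F] [MeasurableSpace F] [BorelSpace F] {f : F → ℂ} {B C : ℝ}
    (hf : AEStronglyMeasurable f) (hC : ∀ v, ‖f v‖ ≤ C) (hB : ∀ v, f v ≠ 0 → ‖v‖ ≤ B) :
    Integrable f := by
  rw [← integrableOn_iff_integrable_of_support_subset (s := Metric.closedBall 0 B)]
  · exact Measure.integrableOn_of_bounded
      (Metric.isBounded_closedBall.measure_lt_top).ne hf (Eventually.of_forall hC)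
  · intro v hv
    simpa using hB v hv

open Classical in
/-- The affine functions `t = -(⟨α, v⟩ + β)` on `V` over which the points of `c + W` at which
an affine function of the family vanishes lie. -/
def breaks (V : Submodule ℝ (EuclideanSpace ℝ (Fin d))) (L : Finset (EuclideanSpace ℝ (Fin d) × ℝ))
    (c u : EuclideanSpace ℝ (Fin d)) : Finset (V × ℝ) :=
  (L.filter fun l => (inner ℝ l.1 u : ℝ) ≠ 0).image fun l =>
    ((inner ℝ l.1 u : ℝ)⁻¹ • V.orthogonalProjectionOnto l.1, affineEval l c / inner ℝ l.1 u)

/-- The value at `v` of the affine function on `V` encoded by `p`. -/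
def breakPoint (p : V × ℝ) (v : V) : ℝ := -(inner ℝ p.1 v + p.2)

open Classical in
/-- The jump of the indicator function of `G` at `y` in the direction `u`. -/
def jump (u : EuclideanSpace ℝ (Fin d)) (G : Set (EuclideanSpace ℝ (Fin d)))
    (y : EuclideanSpace ℝ (Fin d)) : ℝ :=
  (if EntersAlong u G y then 1 else 0) - (if EntersAlong (-u) G y then 1 else 0)

theorem inner_orthogonalProjectionOnto (a : EuclideanSpace ℝ (Fin d)) (v : V) :
    (inner ℝ (V.orthogonalProjectionOnto a) v : ℝ) = inner ℝ a (v : EuclideanSpace ℝ (Fin d)) := by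
  simp

theorem affineEval_eq_mul_sub_breakPoint {l : EuclideanSpace ℝ (Fin d) × ℝ}
    (hl : (inner ℝ l.1 u : ℝ) ≠ 0) (v : V) (t : ℝ) :
    affineEval l (c + (v + t • u)) = inner ℝ l.1 u *
      (t - breakPoint ((inner ℝ l.1 u : ℝ)⁻¹ • V.orthogonalProjectionOnto l.1,
        affineEval l c / inner ℝ l.1 u) v) := by
  have e : (inner ℝ ((inner ℝ l.1 u : ℝ)⁻¹ • V.orthogonalProjectionOnto l.1) v : ℝ) =
      (inner ℝ l.1 u)⁻¹ * inner ℝ l.1 (v : EuclideanSpace ℝ (Fin d)) := by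
    rw [← inner_orthogonalProjectionOnto]
    exact real_inner_smul_left _ _ _
  simp only [breakPoint]
  rw [affineEval_add, e, inner_add_right, inner_smul_right]
  field_simp
  ring

/-- The lines in the direction `u` that avoid all coincidences between the affine functions. -/
structure IsGenericLine (V : Submodule ℝ (EuclideanSpace ℝ (Fin d)))
    (L : Finset (EuclideanSpace ℝ (Fin d) × ℝ)) (c u : EuclideanSpace ℝ (Fin d)) (v : V) : Prop where
  ne_zero : ∀ l ∈ L, (inner ℝ l.1 u : ℝ) = 0 →
    affineEval l (c + (v : EuclideanSpace ℝ (Fin d))) ≠ 0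
  injOn : ∀ p ∈ breaks V L c u, ∀ q ∈ breaks V L c u, breakPoint p v = breakPoint q v → p = q

/-- A function constant along `u` is not constant on `c + W`, so it varies along `V` and vanishes on
a null set of lines only; two different breaks are different affine functions on `V` and agree only
on a null set. -/
theorem ae_isGenericLine (hG : IsAdapted W c L G) (hu : IsNormal V W u) :
    ∀ᵐ v : V, IsGenericLine V L c u v := by
  have h1 : ∀ᵐ v : V, ∀ l ∈ L, (inner ℝ l.1 u : ℝ) = 0 →
      affineEval l (c + (v : EuclideanSpace ℝ (Fin d))) ≠ 0 := by
    rw [eventually_all_finset]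
    intro l hl
    by_cases hlu : (inner ℝ l.1 u : ℝ) = 0
    · have hlt : l ∈ transverse V L := by
        by_contra h
        exact hG.inner_normal_ne_zero hu hl h hlu
      have hne : V.orthogonalProjectionOnto l.1 ≠ 0 := by
        intro h
        obtain ⟨-, w, hw, hlw⟩ := mem_transverse.1 hlt
        have := inner_orthogonalProjectionOnto l.1 ⟨w, hw⟩
        rw [h, inner_zero_left] at this
        exact hlw this.symm
      filter_upwards [ae_inner_add_ne_zero _ (affineEval l c) (Or.inl hne)] with v hv _
      rw [affineEval_add, ← inner_orthogonalProjectionOnto, add_comm]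
      exact hv
    · exact Eventually.of_forall fun v h => absurd h hlu
  have h2 : ∀ᵐ v : V, ∀ p ∈ breaks V L c u, ∀ q ∈ breaks V L c u,
      breakPoint p v = breakPoint q v → p = q := by
    rw [eventually_all_finset]
    intro p hp
    rw [eventually_all_finset]
    intro q hq
    by_cases hpq : p = q
    · exact Eventually.of_forall fun v _ => hpq
    · have hne : p.1 - q.1 ≠ 0 ∨ p.2 - q.2 ≠ 0 := by
        by_contra! h
        exact hpq (Prod.ext (sub_eq_zero.1 h.1) (sub_eq_zero.1 h.2))
      filter_upwards [ae_inner_add_ne_zero _ _ hne] with v hv h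
      exfalso
      apply hv
      rw [inner_sub_left]
      simp only [breakPoint] at h
      linarith
  filter_upwards [h1, h2] with v hv1 hv2 using ⟨hv1, hv2⟩

theorem IsGenericLine.inner_eq_zero_ne {v : V} (hv : IsGenericLine V L c u v) (t : ℝ)
    {l : EuclideanSpace ℝ (Fin d) × ℝ} (hl : l ∈ L) (hlu : (inner ℝ l.1 u : ℝ) = 0) :
    affineEval l (c + (v + t • u)) ≠ 0 := by
  have : c + ((v : EuclideanSpace ℝ (Fin d)) + t • u) = c + v + t • u := by abel
  rw [this, affineEval_add, inner_smul_right, hlu, mul_zero, add_zero]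
  exact hv.ne_zero l hl hlu

/-- A transverse function that varies along `u` yields a break of non-zero slope, so a point met
only by breaks of slope zero is generic. -/
theorem IsGenericLine.affineEval_ne_zero {v : V} (hv : IsGenericLine V L c u v) {t : ℝ}
    (ht : ∀ p ∈ breaks V L c u, breakPoint p v = t → p.1 = 0) :
    ∀ l ∈ transverse V L, affineEval l (c + (v + t • u)) ≠ 0 := by
  classical
  intro l hl
  obtain ⟨hlL, w, hw, hlw⟩ := mem_transverse.1 hl
  by_cases hlu : (inner ℝ l.1 u : ℝ) = 0
  · exact hv.inner_eq_zero_ne t hlL hlu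
  · rw [affineEval_eq_mul_sub_breakPoint hlu]
    refine mul_ne_zero hlu fun h => hlw ?_
    have h0 := ht _ (Finset.mem_image_of_mem _ (Finset.mem_filter.2 ⟨hlL, hlu⟩))
      (sub_eq_zero.1 h).symm
    rw [smul_eq_zero_iff_right (inv_ne_zero hlu)] at h0
    have := inner_orthogonalProjectionOnto l.1 ⟨w, hw⟩
    rw [h0, inner_zero_left] at this
    exact this.symm

theorem entersAlong_mem (hG : IsClosed G) {y : EuclideanSpace ℝ (Fin d)}
    (h : EntersAlong u G y) : y ∈ G :=
  hG.mem_of_tendsto (tendsto_add_smul_nhdsGT y u) h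

theorem mem_of_jump_ne_zero (hG : IsClosed G) {y : EuclideanSpace ℝ (Fin d)}
    (h : jump u G y ≠ 0) : y ∈ G := by
  by_contra hy
  apply h
  rw [jump, if_neg fun h' => hy (entersAlong_mem hG h'),
    if_neg fun h' => hy (entersAlong_mem hG h'), sub_zero]

theorem abs_jump_le (y : EuclideanSpace ℝ (Fin d)) : |jump u G y| ≤ 1 := by
  unfold jump
  split_ifs <;> norm_num

theorem continuous_breakPoint (p : V × ℝ) : Continuous (breakPoint p) := by
  unfold breakPoint; fun_prop

-- On almost every line the entering condition is the limit of the indicator of `G` at points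
-- displaced by `1 / (n + 1)` in the direction `w`.
open Classical in
theorem aestronglyMeasurable_entersAlong (hG : IsAdapted W c L G) (hu : IsNormal V W u)
    {w : EuclideanSpace ℝ (Fin d)} (hw : w = u ∨ w = -u) (p : V × ℝ) :
    AEStronglyMeasurable (fun v : V =>
      if EntersAlong w G (c + (v + breakPoint p v • u)) then (1 : ℝ) else 0) volume := by
  have hlim : Tendsto (fun n : ℕ => 1 / ((n : ℝ) + 1)) atTop (𝓝[>] 0) :=
    tendsto_nhdsWithin_iff.2 ⟨tendsto_one_div_add_atTop_nhds_zero_nat,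
      Eventually.of_forall fun n => by
        have : (0 : ℝ) < 1 / ((n : ℝ) + 1) := by positivity
        exact this⟩
  refine aestronglyMeasurable_of_tendsto_ae atTop (f := fun (n : ℕ) (v : V) =>
    G.indicator (fun _ => (1 : ℝ)) (c + (v + breakPoint p v • u) + (1 / ((n : ℝ) + 1)) • w)) ?_ ?_
  · intro n
    refine Measurable.aestronglyMeasurable ?_
    refine (measurable_const.indicator hG.isClosed.measurableSet).comp ?_
    have := continuous_breakPoint p
    fun_prop
  · filter_upwards [ae_isGenericLine hG hu] with v hv
    have hwW : w ∈ W := by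
      rcases hw with rfl | rfl
      · exact hu.mem
      · exact hu.neg.mem
    have h := hG.eventually_add_smul_mem_iff hwW (y := c + (v + breakPoint p v • u))
      (by simpa using hu.add_smul_mem v.2 _) (fun l hl hlw => hv.inner_eq_zero_ne _ hl (by
        rcases hw with rfl | rfl
        · exact hlw
        · simpa using hlw))
    refine tendsto_const_nhds.congr' ?_
    filter_upwards [hlim.eventually h] with n hn
    rw [Set.indicator_apply]
    simp only [hn]

theorem aestronglyMeasurable_jump (hG : IsAdapted W c L G) (hu : IsNormal V W u) (p : V × ℝ) :
    AEStronglyMeasurable (fun v : V => jump u G (c + (v + breakPoint p v • u))) volume :=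
  (aestronglyMeasurable_entersAlong hG hu (Or.inl rfl) p).sub
    (aestronglyMeasurable_entersAlong hG hu (Or.inr rfl) p)

theorem exists_norm_le_of_isBounded (hG : Bornology.IsBounded G) (hu : IsNormal V W u)
    (c : EuclideanSpace ℝ (Fin d)) :
    ∃ B : ℝ, ∀ (v : V) (t : ℝ), c + (v + t • u) ∈ G → ‖v‖ ≤ B ∧ |t| ≤ B := by
  obtain ⟨B, hB⟩ := hG.exists_norm_le
  refine ⟨B + ‖c‖, fun v t h => ?_⟩
  have h1 : ‖(v : EuclideanSpace ℝ (Fin d)) + t • u‖ ≤ B + ‖c‖ := by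
    have : (v : EuclideanSpace ℝ (Fin d)) + t • u = (c + (v + t • u)) - c := by abel
    rw [this]
    exact (norm_sub_le _ _).trans (by gcongr; exact hB _ h)
  have h2 : ‖(v : EuclideanSpace ℝ (Fin d)) + t • u‖ ^ 2 = ‖v‖ ^ 2 + |t| ^ 2 := by
    rw [norm_add_sq_real, inner_smul_right, real_inner_comm, hu.inner_eq _ v.2, norm_smul,
      hu.norm_eq]
    simp
  have h3 := norm_nonneg ((v : EuclideanSpace ℝ (Fin d)) + t • u)
  constructor
  · refine le_trans ?_ h1
    refine abs_le_of_sq_le_sq' ?_ h3 |>.2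
    rw [h2]; nlinarith [sq_nonneg |t|]
  · refine le_trans ?_ h1
    refine abs_le_of_sq_le_sq' ?_ h3 |>.2
    rw [h2]; nlinarith [sq_nonneg ‖v‖]

theorem integrable_jump (hG : IsAdapted W c L G) (hu : IsNormal V W u) (p : V × ℝ) :
    Integrable (fun v : V => ((jump u G (c + (v + breakPoint p v • u)) : ℝ) : ℂ)) := by
  obtain ⟨B, hB⟩ := exists_norm_le_of_isBounded hG.isBounded hu c
  refine integrable_of_norm_le_of_bounded (B := B) (C := 1)
    (Complex.continuous_ofReal.comp_aestronglyMeasurable (aestronglyMeasurable_jump hG hu p))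
    (fun v => ?_) (fun v hv => ?_)
  · rw [Complex.norm_real]
    exact abs_jump_le _
  · exact (hB v _ (mem_of_jump_ne_zero (u := u) hG.isClosed fun h => hv (by
      rw [h, Complex.ofReal_zero]))).1

end Piece

/-! ### Slicing along the normal and the one-step asymptotics -/

section Slice

variable {d : ℕ} {V W : Submodule ℝ (EuclideanSpace ℝ (Fin d))} {c u : EuclideanSpace ℝ (Fin d)}
  {L : Finset (EuclideanSpace ℝ (Fin d) × ℝ)} {G F : Set (EuclideanSpace ℝ (Fin d))}

theorem expo_smul (ξ x : EuclideanSpace ℝ (Fin d)) (t : ℝ) :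
    expo ξ (t • x) = Complex.exp (2 * Real.pi * Complex.I * ((inner ℝ ξ x : ℝ) : ℂ) * t) := by
  rw [expo, inner_smul_right]
  congr 1
  push_cast
  ring

-- On a generic line the indicator of `G` is a step function whose jumps lie at break points, and
-- the one-dimensional jump formula applies.
open Classical in
theorem mul_integral_slice (hG : IsAdapted W c L G) (hu : IsNormal V W u) {v : V}
    (hv : IsGenericLine V L c u v) (ξ : EuclideanSpace ℝ (Fin d)) :
    -(2 * Real.pi * Complex.I * ((inner ℝ ξ u : ℝ) : ℂ)) *
      ∫ t : ℝ, G.indicator (expo ξ) (c + (v + t • u)) =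
    ∑ p ∈ breaks V L c u, ((jump u G (c + (v + breakPoint p v • u)) : ℝ) : ℂ) *
      expo ξ (c + (v + breakPoint p v • u)) := by
  set k : ℂ := 2 * Real.pi * Complex.I * ((inner ℝ ξ u : ℝ) : ℂ) with hk
  set y : ℝ → EuclideanSpace ℝ (Fin d) := fun t => c + (v + t • u) with hy
  have hyW : ∀ t, y t - c ∈ W := fun t => by simpa [hy] using hu.add_smul_mem v.2 t
  have hyadd : ∀ t s : ℝ, y t + s • u = y (t + s) := fun t s => by
    simp only [hy, add_smul]; abel
  have hexp : ∀ t, expo ξ (y t) = expo ξ (c + v) * Complex.exp (k * t) := fun t => by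
    simp only [hy]
    rw [← add_assoc, expo_add, expo_smul]
  obtain ⟨B, hB⟩ := exists_norm_le_of_isBounded hG.isBounded hu c
  have hR : ∀ t, ∀ᶠ x in 𝓝[>] t, (if y x ∈ G then (1 : ℝ) else 0) =
      if EntersAlong u G (y t) then 1 else 0 := by
    intro t
    have h := hG.eventually_add_smul_mem_iff hu.mem (hyW t)
      (fun l hl hlu => hv.inner_eq_zero_ne t hl hlu)
    have ht : Tendsto (fun x : ℝ => x - t) (𝓝[>] t) (𝓝[>] 0) := by
      refine tendsto_nhdsWithin_iff.2 ⟨?_, ?_⟩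
      · have : Continuous fun x : ℝ => x - t := by fun_prop
        simpa using (this.tendsto t).mono_left nhdsWithin_le_nhds
      · filter_upwards [self_mem_nhdsWithin] with x hx using sub_pos.2 (Set.mem_Ioi.1 hx)
    filter_upwards [ht.eventually h] with x hx
    rw [hyadd, add_sub_cancel] at hx
    simp only [hx]
  have hL : ∀ t, ∀ᶠ x in 𝓝[<] t, (if y x ∈ G then (1 : ℝ) else 0) =
      if EntersAlong (-u) G (y t) then 1 else 0 := by
    intro t
    have h := hG.eventually_add_smul_mem_iff hu.neg.mem (hyW t)
      (fun l hl hlu => hv.inner_eq_zero_ne t hl (by simpa using hlu))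
    have ht : Tendsto (fun x : ℝ => t - x) (𝓝[<] t) (𝓝[>] 0) := by
      refine tendsto_nhdsWithin_iff.2 ⟨?_, ?_⟩
      · have : Continuous fun x : ℝ => t - x := by fun_prop
        simpa using (this.tendsto t).mono_left nhdsWithin_le_nhds
      · filter_upwards [self_mem_nhdsWithin] with x hx using sub_pos.2 (Set.mem_Iio.1 hx)
    filter_upwards [ht.eventually h] with x hx
    rw [smul_neg, ← neg_smul, hyadd, neg_sub, add_sub_cancel] at hx
    simp only [hx]
  set T : Finset ℝ := (breaks V L c u).image fun p => breakPoint p v with hT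
  have hoff : ∀ t ∉ T, ∀ᶠ x in 𝓝 t, (y x ∈ G ↔ y t ∈ G) := by
    intro t ht
    have hne : ∀ l ∈ L, affineEval l (y t) ≠ 0 := by
      intro l hl
      by_cases hlu : (inner ℝ l.1 u : ℝ) = 0
      · exact hv.inner_eq_zero_ne t hl hlu
      · simp only [hy]
        rw [affineEval_eq_mul_sub_breakPoint hlu]
        refine mul_ne_zero hlu fun h => ht ?_
        rw [sub_eq_zero.1 h, hT]
        exact Finset.mem_image_of_mem _
          (Finset.mem_image_of_mem _ (Finset.mem_filter.2 ⟨hl, hlu⟩))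
    have key : ∀ᶠ x in 𝓝 t, ∀ l ∈ L, 0 < affineEval l (y x) * affineEval l (y t) := by
      rw [Finset.eventually_all]
      intro l hl
      have : Continuous fun x => affineEval l (y x) * affineEval l (y t) := by
        simp only [hy, affineEval]; fun_prop
      exact this.continuousAt.eventually_const_lt (mul_self_pos.2 (hne l hl))
    filter_upwards [key] with x hx using hG.mem_congr _ _ (hyW x) (hyW t) hx
  have hoffR : ∀ t ∉ T, (if EntersAlong u G (y t) then (1 : ℝ) else 0) =
      if y t ∈ G then 1 else 0 := by
    intro t ht
    obtain ⟨x, h1, h2⟩ := ((hR t).and ((hoff t ht).filter_mono nhdsWithin_le_nhds)).exists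
    rw [← h1]
    simp only [h2]
  have hoffL : ∀ t ∉ T, (if EntersAlong (-u) G (y t) then (1 : ℝ) else 0) =
      if y t ∈ G then 1 else 0 := by
    intro t ht
    obtain ⟨x, h1, h2⟩ := ((hL t).and ((hoff t ht).filter_mono nhdsWithin_le_nhds)).exists
    rw [← h1]
    simp only [h2]
  have main := integral_mul_exp_eq_sum_jumps (f := fun t => if y t ∈ G then (1 : ℝ) else 0)
    (M := B) T (fun x hx => (hB v x (by
      by_contra h
      exact hx (if_neg h))).2) hR hL (fun t ht => (hoffR t ht).trans (hoffL t ht).symm)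
    (fun t ht => (hoffL t ht).symm) k
  have e1 : (fun t : ℝ => G.indicator (expo ξ) (c + (v + t • u))) = fun t =>
      expo ξ (c + v) * (((if y t ∈ G then (1 : ℝ) else 0 : ℝ) : ℂ) * Complex.exp (k * t)) := by
    ext t
    change G.indicator (expo ξ) (y t) = _
    by_cases h : y t ∈ G
    · rw [Set.indicator_of_mem h, hexp]
      simp [h]
    · rw [Set.indicator_of_notMem h]
      simp [h]
  -- On a generic line different breaks have different break points, so the sum over positions is a
  -- sum over breaks.
  rw [e1, integral_const_mul, mul_left_comm, main, Finset.mul_sum, hT,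
    Finset.sum_image fun p hp q hq h => hv.injOn p hp q hq h]
  refine Finset.sum_congr rfl fun p _ => ?_
  change _ = ((jump u G (y (breakPoint p v)) : ℝ) : ℂ) * expo ξ (y (breakPoint p v))
  rw [hexp]
  simp only [jump]
  ring

/-- Integration along the direction `u` turns the Fourier integral of `G` into integrals over `V`,
one for each affine function at which jumps occur. -/
theorem mul_pieceIntegral_eq_sum {k : ℕ} (hk : Module.finrank ℝ W = k)
    (hG : IsAdapted W c L G) (hu : IsNormal V W u) (ξ : EuclideanSpace ℝ (Fin d)) :
    -(2 * Real.pi * Complex.I * ((inner ℝ ξ u : ℝ) : ℂ)) * pieceIntegral k G ξ =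
    ∑ p ∈ breaks V L c u, ∫ v : V, ((jump u G (c + (v + breakPoint p v • u)) : ℝ) : ℂ) *
      expo ξ (c + (v + breakPoint p v • u)) := by
  obtain ⟨B, hB⟩ := hG.isBounded.exists_norm_le
  have hint : Integrable (fun w : W => G.indicator (expo ξ) (c + w)) := by
    refine integrable_of_norm_le_of_bounded (B := B + ‖c‖) (C := 1) ?_ ?_ ?_
    · refine Measurable.aestronglyMeasurable ?_
      exact ((continuous_expo ξ).measurable.indicator hG.isClosed.measurableSet).comp
        (by fun_prop)
    · intro w
      refine (norm_indicator_le_norm_self _ _).trans (norm_expo _ _).le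
    · intro w hw
      have h1 := hB _ (Set.mem_of_indicator_ne_zero hw)
      have : (w : EuclideanSpace ℝ (Fin d)) = (c + w) - c := by abel
      change ‖(w : EuclideanSpace ℝ (Fin d))‖ ≤ _
      rw [this]
      exact (norm_sub_le _ _).trans (by gcongr)
  have hfub : Integrable (fun p : V × ℝ => G.indicator (expo ξ) (c + (p.1 + p.2 • u)))
      (volume.prod volume) :=
    (hu.measurePreserving.integrable_comp_emb hu.measurableEmbedding).2 hint
  rw [pieceIntegral, setIntegral_euclideanHausdorffMeasure hk hG.isClosed.measurableSet hG.sub_mem,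
    ← hu.measurePreserving.integral_comp hu.measurableEmbedding,
    Measure.volume_eq_prod]
  change _ * ∫ p : V × ℝ, G.indicator (expo ξ) (c + (p.1 + p.2 • u)) ∂_ = _
  rw [integral_prod _ hfub, ← integral_const_mul, ← integral_finsetSum]
  · refine integral_congr_ae ?_
    filter_upwards [ae_isGenericLine hG hu] with v hv
    exact mul_integral_slice hG hu hv ξ
  · intro p _
    refine (integrable_jump hG hu p).mul_bdd (c := 1) ?_ ?_
    · refine Continuous.aestronglyMeasurable ?_
      have := continuous_breakPoint p
      exact (continuous_expo ξ).comp (by fun_prop)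
    · exact Eventually.of_forall fun v => (norm_expo _ _).le

-- The breaks of slope zero are those of the functions constant along `V`, whose zeros define the
-- levels.
open Classical in
theorem sum_breaks_eq_sum_levels (hG : IsAdapted W c L G) (hu : IsNormal V W u) (φ : ℝ → ℂ) :
    ∑ p ∈ breaks V L c u with p.1 = 0, φ (-p.2) = ∑ t ∈ levels V L c u, φ t := by
  refine Finset.sum_bij (fun p _ => -p.2) ?_ ?_ ?_ ?_
  · intro p hp
    rw [Finset.mem_filter, breaks, Finset.mem_image] at hp
    obtain ⟨⟨l, hl, rfl⟩, h0⟩ := hp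
    rw [Finset.mem_filter] at hl
    simp only [levels, Finset.mem_image, Finset.mem_sdiff]
    refine ⟨l, ⟨hl.1, fun h => ?_⟩, by rw [neg_div]⟩
    obtain ⟨-, w, hw, hlw⟩ := mem_transverse.1 h
    have h0' := (smul_eq_zero_iff_right (inv_ne_zero hl.2)).1 h0
    have := inner_orthogonalProjectionOnto l.1 ⟨w, hw⟩
    rw [h0', inner_zero_left] at this
    exact hlw this.symm
  · intro p hp q hq h
    exact Prod.ext ((Finset.mem_filter.1 hp).2.trans (Finset.mem_filter.1 hq).2.symm)
      (neg_injective h)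
  · intro t ht
    simp only [levels, Finset.mem_image, Finset.mem_sdiff] at ht
    obtain ⟨l, ⟨hl, hlt⟩, rfl⟩ := ht
    have hlu := hG.inner_normal_ne_zero hu hl hlt
    refine ⟨_, Finset.mem_filter.2 ⟨Finset.mem_image_of_mem _
      (Finset.mem_filter.2 ⟨hl, hlu⟩), ?_⟩, by rw [neg_div]⟩
    have : V.orthogonalProjectionOnto l.1 = 0 := by
      refine ext_inner_right ℝ fun w => ?_
      rw [inner_orthogonalProjectionOnto, inner_zero_left]
      exact inner_eq_zero_of_notMem_transverse hl hlt _ w.2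
    simp [this]
  · intro p _
    rfl

open Classical in
/-- At a constant break the jumps are given by the facets at that level. -/
theorem integral_jump_eq_pieceIntegral_sub {k : ℕ} (hk : Module.finrank ℝ V = k)
    (hG : IsAdapted W c L G) (hu : IsNormal V W u) (ξ : EuclideanSpace ℝ (Fin d)) {p : V × ℝ}
    (hp : p ∈ breaks V L c u) (hp0 : p.1 = 0) :
    ∫ v : V, ((jump u G (c + (v + breakPoint p v • u)) : ℝ) : ℂ) *
      expo ξ (c + (v + breakPoint p v • u)) =
    pieceIntegral k (closure (openFacet V (halfSpace W u) G (c + (-p.2) • u))) ξ -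
      pieceIntegral k (closure (openFacet V (halfSpace W (-u)) G (c + (-p.2) • u))) ξ := by
  set t := -p.2 with ht
  have hbp : ∀ v, breakPoint p v = t := fun v => by
    rw [breakPoint, hp0, inner_zero_left, zero_add]
  have hint : ∀ D : Set (EuclideanSpace ℝ (Fin d)), (0 : EuclideanSpace ℝ (Fin d)) ∈ D →
      Integrable (fun v : V => (closure (openFacet V D G (c + t • u))).indicator (expo ξ)
        (c + t • u + v)) := by
    intro D hD
    obtain ⟨B, hB⟩ := exists_norm_le_of_isBounded hG.isBounded hu c
    refine integrable_of_norm_le_of_bounded (B := B) (C := 1) ?_ ?_ ?_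
    · refine Measurable.aestronglyMeasurable ?_
      exact ((continuous_expo ξ).measurable.indicator isClosed_closure.measurableSet).comp
        (by fun_prop)
    · intro w
      exact (norm_indicator_le_norm_self _ _).trans (norm_expo _ _).le
    · intro v hv
      refine (hB v t ?_).1
      have := closure_openFacet_subset hD hG.isClosed (Set.mem_of_indicator_ne_zero hv)
      rwa [show c + ((v : EuclideanSpace ℝ (Fin d)) + t • u) = c + t • u + v by abel]
  rw [pieceIntegral, pieceIntegral,
    setIntegral_euclideanHausdorffMeasure hk isClosed_closure.measurableSet
      (fun y hy => sub_mem_of_mem_closure_openFacet hy),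
    setIntegral_euclideanHausdorffMeasure hk isClosed_closure.measurableSet
      (fun y hy => sub_mem_of_mem_closure_openFacet hy),
    ← integral_sub (hint _ zero_mem_halfSpace) (hint _ zero_mem_halfSpace)]
  refine integral_congr_ae ?_
  filter_upwards [ae_isGenericLine hG hu] with v hv
  rw [hbp v]
  -- On a generic line any break through this point is `p` itself, hence of slope zero.
  have hgen : ∀ l ∈ transverse V L, affineEval l (c + (v + t • u)) ≠ 0 :=
    hv.affineEval_ne_zero fun q hq hqt =>
      (hv.injOn q hq p hp (hqt.trans (hbp v).symm)) ▸ hp0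
  have hyc : c + ((v : EuclideanSpace ℝ (Fin d)) + t • u) - c ∈ W := by
    simpa using hu.add_smul_mem v.2 t
  have hyx : c + ((v : EuclideanSpace ℝ (Fin d)) + t • u) - (c + t • u) ∈ V := by
    have : c + ((v : EuclideanSpace ℝ (Fin d)) + t • u) - (c + t • u) = v := by abel
    rw [this]
    exact v.2
  have h1 := hG.mem_closure_openFacet_iff hu hyc hgen hyx
  have h2 := hG.mem_closure_openFacet_iff hu.neg hyc hgen hyx
  rw [neg_neg] at h2
  rw [show c + t • u + (v : EuclideanSpace ℝ (Fin d)) = c + (v + t • u) by abel]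
  simp only [Set.indicator_apply, h1, h2, jump]
  by_cases ha : EntersAlong u G (c + (v + t • u)) <;>
    by_cases hb : EntersAlong (-u) G (c + (v + t • u)) <;> simp [ha, hb]

/-- Over the graph of the break, `e_ξ` has on `V` the frequency `P ξ - s p.1`, where `P` is the
projection to `V` and `s = ⟨ξ, u⟩`. It is at least `|s| ‖p.1‖ - M` in norm, which exceeds the
Riemann–Lebesgue radius `R` once `|s| ≥ (R + M) / ‖p.1‖`. -/
theorem exists_norm_integral_jump_le {p : V × ℝ}
    (hp0 : p.1 ≠ 0) {ε : ℝ} (hε : 0 < ε) (M : ℝ) :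
    ∃ T : ℝ, ∀ ξ : EuclideanSpace ℝ (Fin d), ‖V.orthogonalProjectionOnto ξ‖ ≤ M →
      T ≤ |(inner ℝ ξ u : ℝ)| →
      ‖∫ v : V, ((jump u G (c + (v + breakPoint p v • u)) : ℝ) : ℂ) *
        expo ξ (c + (v + breakPoint p v • u))‖ ≤ ε := by
  obtain ⟨R, hR⟩ := exists_norm_integral_mul_exp_le
    (fun v : V => ((jump u G (c + (v + breakPoint p v • u)) : ℝ) : ℂ)) hε
  have hpos : 0 < ‖p.1‖ := norm_pos_iff.2 hp0
  refine ⟨(R + M) / ‖p.1‖, fun ξ hM hT => ?_⟩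
  set s : ℝ := inner ℝ ξ u
  have hw : R ≤ ‖V.orthogonalProjectionOnto ξ - s • p.1‖ := by
    have h1 : ‖s • p.1‖ ≤ ‖V.orthogonalProjectionOnto ξ - s • p.1‖ +
        ‖V.orthogonalProjectionOnto ξ‖ := by
      have := norm_sub_le (V.orthogonalProjectionOnto ξ)
        (V.orthogonalProjectionOnto ξ - s • p.1)
      rw [sub_sub_cancel] at this
      linarith
    rw [norm_smul, Real.norm_eq_abs] at h1
    rw [div_le_iff₀ hpos] at hT
    linarith
  refine le_of_eq_of_le ?_ (hR _ hw)
  have e : ∀ v : V, expo ξ (c + (v + breakPoint p v • u)) = expo ξ (c + (-p.2) • u) *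
      Complex.exp (2 * Real.pi * Complex.I *
        ((inner ℝ (V.orthogonalProjectionOnto ξ - s • p.1) v : ℝ) : ℂ)) := by
    intro v
    rw [expo, expo, ← Complex.exp_add, ← mul_add, ← Complex.ofReal_add]
    congr 4
    simp only [breakPoint]
    rw [inner_sub_left, inner_orthogonalProjectionOnto, real_inner_smul_left, inner_add_right,
      inner_add_right, inner_add_right, inner_smul_right, inner_smul_right]
    ring
  have e2 : (fun v : V => ((jump u G (c + (v + breakPoint p v • u)) : ℝ) : ℂ) *
      expo ξ (c + (v + breakPoint p v • u))) = fun v => expo ξ (c + (-p.2) • u) *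
        (((jump u G (c + (v + breakPoint p v • u)) : ℝ) : ℂ) * Complex.exp (2 * Real.pi * Complex.I *
        ((inner ℝ (V.orthogonalProjectionOnto ξ - s • p.1) v : ℝ) : ℂ))) := by
    ext v
    rw [e]; ring
  rw [e2, integral_const_mul, norm_mul, norm_expo, one_mul]

/-- In the direction normal to `V`, the Fourier integral of `G` is asymptotically given by the
facets of `G` parallel to `V`. -/
theorem exists_norm_mul_pieceIntegral_sub_le {k : ℕ} (hk : Module.finrank ℝ V = k)
    (hk1 : Module.finrank ℝ W = k + 1) (hG : IsAdapted W c L G) (hu : IsNormal V W u) {ε : ℝ}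
    (hε : 0 < ε) (M : ℝ) :
    ∃ T : ℝ, ∀ ξ : EuclideanSpace ℝ (Fin d), ‖V.orthogonalProjectionOnto ξ‖ ≤ M →
      T ≤ |(inner ℝ ξ u : ℝ)| →
      ‖-(2 * Real.pi * Complex.I * ((inner ℝ ξ u : ℝ) : ℂ)) * pieceIntegral (k + 1) G ξ -
        ∑ t ∈ levels V L c u,
          (pieceIntegral k (closure (openFacet V (halfSpace W u) G (c + t • u))) ξ -
            pieceIntegral k (closure (openFacet V (halfSpace W (-u)) G (c + t • u))) ξ)‖ ≤ ε := by
  classical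
  set N := (breaks V L c u).card
  -- Each non-constant break receives an equal share of `ε`; the `+ 1` covers the case of no breaks.
  have hε' : 0 < ε / (N + 1) := by positivity
  have h : ∀ p : V × ℝ, ∃ T : ℝ, p.1 ≠ 0 → ∀ ξ : EuclideanSpace ℝ (Fin d),
      ‖V.orthogonalProjectionOnto ξ‖ ≤ M → T ≤ |(inner ℝ ξ u : ℝ)| →
      ‖∫ v : V, ((jump u G (c + (v + breakPoint p v • u)) : ℝ) : ℂ) *
        expo ξ (c + (v + breakPoint p v • u))‖ ≤ ε / (N + 1) := by
    intro p
    by_cases hp : p.1 = 0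
    · exact ⟨0, fun h => absurd hp h⟩
    · obtain ⟨T, hT⟩ := exists_norm_integral_jump_le (c := c) (u := u) (G := G) hp hε' M
      exact ⟨T, fun _ => hT⟩
  choose T hT using h
  refine ⟨∑ p ∈ breaks V L c u, |T p|, fun ξ hM hξ => ?_⟩
  rw [mul_pieceIntegral_eq_sum hk1 hG hu ξ, ← Finset.sum_filter_add_sum_filter_not _
    (fun p : V × ℝ => p.1 = 0), ← sum_breaks_eq_sum_levels hG hu
    (fun t => pieceIntegral k (closure (openFacet V (halfSpace W u) G (c + t • u))) ξ -
            pieceIntegral k (closure (openFacet V (halfSpace W (-u)) G (c + t • u))) ξ),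
    Finset.sum_congr rfl fun p hp => integral_jump_eq_pieceIntegral_sub hk hG hu ξ
      (Finset.mem_filter.1 hp).1 (Finset.mem_filter.1 hp).2, add_sub_cancel_left]
  refine (norm_sum_le_of_le _ fun p hp => hT p (Finset.mem_filter.1 hp).2 ξ hM ?_).trans ?_
  · refine (le_abs_self _).trans (le_trans ?_ hξ)
    exact Finset.single_le_sum (f := fun p => |T p|) (fun _ _ => abs_nonneg _)
      (Finset.mem_filter.1 hp).1
  · rw [Finset.sum_const, nsmul_eq_mul, mul_div_assoc', div_le_iff₀ (by positivity), mul_comm]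
    gcongr
    have : ((breaks V L c u).filter fun p => ¬ p.1 = 0).card ≤ N := Finset.card_filter_le _ _
    have : (((breaks V L c u).filter fun p => ¬ p.1 = 0).card : ℝ) ≤ N := by exact_mod_cast this
    linarith

end Slice

/-! ### Iteration along the flag -/

section Flag

variable {d r : ℕ} {Φ : RFlag d r} {A G : Set (EuclideanSpace ℝ (Fin d))}

/-- The sequences of faces from level `r` up to a set `G` at level `k`. -/
def sequencesTo (Φ : RFlag d r) (k : ℕ) (G : Set (EuclideanSpace ℝ (Fin d))) :
    Set (ℕ → Set (EuclideanSpace ℝ (Fin d))) :=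
  {F | (∀ j < r, F j = ∅) ∧ (∀ j, k ≤ j → F j = G) ∧
    ∀ j, r ≤ j → j < k →
      IsFacet (Φ.V j) (Φ.pos j) (F (j + 1)) (F j) ∨ IsFacet (Φ.V j) (Φ.neg j) (F (j + 1)) (F j)}

/-- The facets of `G` at level `k`. -/
def facets (Φ : RFlag d r) (k : ℕ) (G : Set (EuclideanSpace ℝ (Fin d))) :
    Set (Set (EuclideanSpace ℝ (Fin d))) :=
  {H | IsFacet (Φ.V k) (Φ.pos k) G H ∨ IsFacet (Φ.V k) (Φ.neg k) G H}

open Classical in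
/-- The side from which `G` adjoins `H`. -/
def facetSign (Φ : RFlag d r) (k : ℕ) (G H : Set (EuclideanSpace ℝ (Fin d))) : ℝ :=
  if IsFacet (Φ.V k) (Φ.pos k) G H then 1 else -1

/-- Put `G` on top of a sequence of faces ending at level `k`. -/
def extendSequence (k : ℕ) (G : Set (EuclideanSpace ℝ (Fin d)))
    (F : ℕ → Set (EuclideanSpace ℝ (Fin d))) : ℕ → Set (EuclideanSpace ℝ (Fin d)) :=
  fun j => if j ≤ k then F j else G

theorem extendSequence_of_le {k j : ℕ} (h : j ≤ k) (F : ℕ → Set (EuclideanSpace ℝ (Fin d))) :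
    extendSequence k G F j = F j := if_pos h

theorem extendSequence_of_lt {k j : ℕ} (h : k < j) (F : ℕ → Set (EuclideanSpace ℝ (Fin d))) :
    extendSequence k G F j = G := if_neg h.not_ge

theorem sequencesTo_self (Φ : RFlag d r) (G : Set (EuclideanSpace ℝ (Fin d))) :
    sequencesTo Φ r G = {fun j => if j < r then ∅ else G} := by
  ext F
  rw [Set.mem_singleton_iff]
  constructor
  · rintro ⟨h1, h2, -⟩
    ext1 j
    split_ifs with h
    · exact h1 j h
    · exact h2 j (not_lt.1 h)
  · rintro rfl
    exact ⟨fun j hj => if_pos hj, fun j hj => if_neg hj.not_gt,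
      fun j h1 h2 => absurd h2 h1.not_gt⟩

/-- Recursion on the top face: truncating at level `k` and continuing with the constant value `F k`
gives a sequence up to the facet `F k`. -/
theorem sequencesTo_succ {k : ℕ} (hk : r ≤ k) :
    sequencesTo Φ (k + 1) G =
      ⋃ H ∈ facets Φ k G, extendSequence k G '' sequencesTo Φ k H := by
  ext F
  simp only [Set.mem_iUnion, Set.mem_image]
  constructor
  · rintro ⟨h1, h2, h3⟩
    refine ⟨F k, ?_, fun j => if j ≤ k then F j else F k, ⟨?_, ?_, ?_⟩, ?_⟩
    · have := h3 k hk (Nat.lt_succ_self k)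
      rwa [h2 _ le_rfl] at this
    · intro j hj
      simp only
      rw [if_pos (hj.le.trans hk), h1 j hj]
    · intro j hj
      simp only
      split_ifs with h
      · rw [le_antisymm h hj]
      · rfl
    · intro j hj hjk
      simp only
      rw [if_pos hjk.le, if_pos (Nat.succ_le_of_lt hjk)]
      exact h3 j hj (hjk.trans (Nat.lt_succ_self k))
    · ext1 j
      rcases le_or_gt j k with h | h
      · rw [extendSequence_of_le h, if_pos h]
      · rw [extendSequence_of_lt h, h2 j h]
  · rintro ⟨H, hH, F, ⟨h1, h2, h3⟩, rfl⟩
    refine ⟨fun j hj => ?_, fun j hj => extendSequence_of_lt hj F, fun j hj hjk => ?_⟩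
    · rw [extendSequence_of_le (hj.le.trans hk), h1 j hj]
    · rw [extendSequence_of_le (Nat.lt_succ_iff.1 hjk)]
      rcases (Nat.lt_succ_iff.1 hjk).lt_or_eq with h | rfl
      · rw [extendSequence_of_le (Nat.succ_le_of_lt h)]
        exact h3 j hj h
      · rw [extendSequence_of_lt (Nat.lt_succ_self j), h2 j le_rfl]
        exact hH

theorem injOn_extendSequence {k : ℕ} (H : Set (EuclideanSpace ℝ (Fin d))) :
    Set.InjOn (extendSequence k G) (sequencesTo Φ k H) := by
  intro F hF F' hF' h
  ext1 j
  rcases le_or_gt j k with hj | hj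
  · have := congrFun h j
    rwa [extendSequence_of_le hj, extendSequence_of_le hj] at this
  · rw [hF.2.1 j hj.le, hF'.2.1 j hj.le]

theorem sign_extendSequence_of_lt {k j : ℕ} (hj : j < k)
    (F : ℕ → Set (EuclideanSpace ℝ (Fin d))) :
    sign Φ (extendSequence k G F) j = sign Φ F j := by
  unfold sign
  rw [extendSequence_of_le hj.le, extendSequence_of_le (Nat.succ_le_of_lt hj)]

theorem sign_extendSequence_self {k : ℕ} {H : Set (EuclideanSpace ℝ (Fin d))}
    {F : ℕ → Set (EuclideanSpace ℝ (Fin d))} (hF : F ∈ sequencesTo Φ k H) :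
    sign Φ (extendSequence k G F) k = facetSign Φ k G H := by
  unfold sign facetSign
  rw [extendSequence_of_le le_rfl, extendSequence_of_lt (Nat.lt_succ_self k), hF.2.1 k le_rfl]

/-- The signed sum of the Fourier integrals of the lowest faces in the sequences up to `G`. -/
def faceSum (Φ : RFlag d r) (k : ℕ) (G : Set (EuclideanSpace ℝ (Fin d)))
    (ξ : EuclideanSpace ℝ (Fin d)) : ℂ :=
  ∑ᶠ F ∈ sequencesTo Φ k G, ((∏ j ∈ Finset.Ico r k, sign Φ F j : ℝ) : ℂ) * pieceIntegral r (F r) ξ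

theorem faceSum_self (ξ : EuclideanSpace ℝ (Fin d)) :
    faceSum Φ r G ξ = pieceIntegral r G ξ := by
  rw [faceSum, sequencesTo_self, finsum_mem_singleton]
  simp

theorem faceSum_succ {k : ℕ} (hk : r ≤ k) (hfin : (facets Φ k G).Finite)
    (hseq : ∀ H ∈ facets Φ k G, (sequencesTo Φ k H).Finite) (ξ : EuclideanSpace ℝ (Fin d)) :
    faceSum Φ (k + 1) G ξ =
      ∑ᶠ H ∈ facets Φ k G, (facetSign Φ k G H : ℂ) * faceSum Φ k H ξ := by
  rw [faceSum, sequencesTo_succ hk, finsum_mem_biUnion _ hfin fun H hH => (hseq H hH).image _]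
  · refine finsum_mem_congr rfl fun H hH => ?_
    rw [finsum_mem_image (injOn_extendSequence H), faceSum, mul_finsum_mem]
    refine finsum_mem_congr rfl fun F hF => ?_
    rw [Finset.prod_Ico_succ_top hk, sign_extendSequence_self hF, extendSequence_of_le hk,
      Finset.prod_congr rfl fun j hj => sign_extendSequence_of_lt (Finset.mem_Ico.1 hj).2 F]
    push_cast
    ring
  -- The families for different facets are disjoint, since the entry at `k` recovers the facet.
  · intro H _ H' _ hne
    rw [Function.onFun, Set.disjoint_left]
    rintro _ ⟨F, hF, rfl⟩ ⟨F', hF', h⟩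
    apply hne
    have := congrFun h k
    rw [extendSequence_of_le le_rfl, extendSequence_of_le le_rfl, hF.2.1 k le_rfl,
      hF'.2.1 k le_rfl] at this
    exact this.symm

/-- `u` is the sequence of unit normals of a flag, pointing to the positive sides. -/
def IsNormals (Φ : RFlag d r) (u : ℕ → EuclideanSpace ℝ (Fin d)) : Prop :=
  ∀ j, r ≤ j → j < d → IsNormal (Φ.V j) (Φ.V (j + 1)) (u j) ∧
    Φ.pos j = halfSpace (Φ.V (j + 1)) (u j)

theorem exists_isNormals (Φ : RFlag d r) : ∃ u, IsNormals Φ u := by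
  have h : ∀ j, ∃ u, r ≤ j → j < d → IsNormal (Φ.V j) (Φ.V (j + 1)) u ∧
      Φ.pos j = halfSpace (Φ.V (j + 1)) u := by
    intro j
    by_cases hj : r ≤ j ∧ j < d
    · obtain ⟨u, hu⟩ := exists_isNormal_of_isHalfSpace (Φ.le_succ j hj.1 hj.2)
        (by rw [Φ.finrank_eq j hj.1 hj.2.le, Φ.finrank_eq (j + 1) (by omega) (by omega)])
        (Φ.isHalfSpace j hj.1 hj.2)
      exact ⟨u, fun _ _ => hu⟩
    · exact ⟨0, fun h1 h2 => absurd ⟨h1, h2⟩ hj⟩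
  choose u hu using h
  exact ⟨u, hu⟩

theorem IsNormals.neg_eq {u : ℕ → EuclideanSpace ℝ (Fin d)} (hu : IsNormals Φ u) {j : ℕ}
    (hj : r ≤ j) (hjd : j < d) : Φ.neg j = halfSpace (Φ.V (j + 1)) (-u j) := by
  ext z
  simp only [RFlag.neg, (hu j hj hjd).2, halfSpace, Set.mem_ofPred_eq, inner_neg_left,
    inner_neg_right, neg_mem_iff]

theorem RFlag.mono (Φ : RFlag d r) {j k : ℕ} (hj : r ≤ j) (hjk : j ≤ k) (hk : k ≤ d) :
    Φ.V j ≤ Φ.V k := by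
  induction k, hjk using Nat.le_induction with
  | base => exact le_rfl
  | succ n hn ih => exact (ih (by omega)).trans (Φ.le_succ n (by omega) (by omega))

/-- `ξ` grows sufficiently fast, as prescribed by `T`, along the normals of the flag. -/
def IsLacunary (Φ : RFlag d r) (u : ℕ → EuclideanSpace ℝ (Fin d)) (T : ℝ → ℝ) (k : ℕ)
    (ξ : EuclideanSpace ℝ (Fin d)) : Prop :=
  ∀ j, r ≤ j → j < k → ∃ M, ‖(Φ.V j).orthogonalProjectionOnto ξ‖ ≤ M ∧
    T M ≤ |(inner ℝ ξ (u j) : ℝ)|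

theorem IsLacunary.mono {u : ℕ → EuclideanSpace ℝ (Fin d)} {T T' : ℝ → ℝ} {k k' : ℕ}
    {ξ : EuclideanSpace ℝ (Fin d)} (h : IsLacunary Φ u T k ξ) (hT : ∀ M, T' M ≤ T M)
    (hk : k' ≤ k) : IsLacunary Φ u T' k' ξ := fun j hj hjk => by
  obtain ⟨M, h1, h2⟩ := h j hj (hjk.trans_le hk)
  exact ⟨M, h1, (hT M).trans h2⟩

/-- The factor `-2πi⟨ξ, u⟩`. -/
def normalFactor (ξ u : EuclideanSpace ℝ (Fin d)) : ℂ :=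
  -(2 * Real.pi * Complex.I * ((inner ℝ ξ u : ℝ) : ℂ))

theorem norm_normalFactor (ξ u : EuclideanSpace ℝ (Fin d)) :
    ‖normalFactor ξ u‖ = 2 * Real.pi * |(inner ℝ ξ u : ℝ)| := by
  simp [normalFactor, abs_of_pos Real.pi_pos]

/-- The normals below level `k` lie in `V k`, so their products with `ξ` are bounded by its
projection to `V k`. The error of the next step can therefore be controlled by a threshold depending
on `M` only. -/
theorem norm_prod_normalFactor_le {u : ℕ → EuclideanSpace ℝ (Fin d)} (hu : IsNormals Φ u) {k : ℕ}
    (hk : k ≤ d) {ξ : EuclideanSpace ℝ (Fin d)} {M : ℝ}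
    (hM : ‖(Φ.V k).orthogonalProjectionOnto ξ‖ ≤ M) :
    ‖∏ j ∈ Finset.Ico r k, normalFactor ξ (u j)‖ ≤ (2 * Real.pi * |M|) ^ (k - r) := by
  rw [norm_prod, ← Nat.card_Ico, ← Finset.prod_const]
  refine Finset.prod_le_prod (fun _ _ => norm_nonneg _) fun j hj => ?_
  obtain ⟨hj1, hj2⟩ := Finset.mem_Ico.1 hj
  rw [norm_normalFactor]
  have hn := (hu j hj1 (by omega)).1
  have hmem : u j ∈ Φ.V k := Φ.mono (by omega) (Nat.succ_le_of_lt hj2) hk hn.mem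
  have h1 : (inner ℝ ξ (u j) : ℝ) = inner ℝ ((Φ.V k).orthogonalProjectionOnto ξ)
      (⟨u j, hmem⟩ : Φ.V k) := (inner_orthogonalProjectionOnto (V := Φ.V k) ξ ⟨u j, hmem⟩).symm
  have h2 : |(inner ℝ ξ (u j) : ℝ)| ≤ |M| := by
    rw [h1]
    refine (abs_real_inner_le_norm _ _).trans ?_
    have : ‖(⟨u j, hmem⟩ : Φ.V k)‖ = 1 := hn.norm_eq
    rw [this, mul_one]
    exact hM.trans (le_abs_self M)
  gcongr

theorem facets_finite {u : ℕ → EuclideanSpace ℝ (Fin d)} (hu : IsNormals Φ u) {k : ℕ}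
    (hk : r ≤ k) (hkd : k < d) {c : EuclideanSpace ℝ (Fin d)}
    {L : Finset (EuclideanSpace ℝ (Fin d) × ℝ)} (hG : IsAdapted (Φ.V (k + 1)) c L G) :
    (facets Φ k G).Finite := by
  rw [facets, hu.neg_eq hk hkd, (hu k hk hkd).2]
  exact finite_setOf_isFacet hG (hu k hk hkd).1

theorem isAdapted_of_mem_facets {u : ℕ → EuclideanSpace ℝ (Fin d)} (hu : IsNormals Φ u) {k : ℕ}
    (hk : r ≤ k) (hkd : k < d) {c : EuclideanSpace ℝ (Fin d)}
    {L : Finset (EuclideanSpace ℝ (Fin d) × ℝ)} (hG : IsAdapted (Φ.V (k + 1)) c L G)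
    {H : Set (EuclideanSpace ℝ (Fin d))} (hH : H ∈ facets Φ k G) :
    ∃ x, IsAdapted (Φ.V k) x (transverse (Φ.V k) L) H := by
  have hn := (hu k hk hkd).1
  rw [facets, hu.neg_eq hk hkd, (hu k hk hkd).2] at hH
  have hmem : ∀ t : ℝ, c + t • u k - c ∈ Φ.V (k + 1) := fun t => by
    simpa using (Φ.V (k + 1)).smul_mem t hn.mem
  rcases hH with hH | hH
  · obtain ⟨-, t, -, rfl⟩ := (isFacet_halfSpace_iff hG hn).1 hH
    exact ⟨_, hG.closure_openFacet hn (hmem t)⟩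
  · obtain ⟨-, t, -, rfl⟩ := (isFacet_halfSpace_neg_iff hG hn).1 hH
    exact ⟨_, hG.closure_openFacet hn.neg (hmem t)⟩

open Classical in
theorem exists_norm_normalFactor_mul_sub_le {u : ℕ → EuclideanSpace ℝ (Fin d)}
    (hu : IsNormals Φ u) {k : ℕ} (hk : r ≤ k) (hkd : k < d) {c : EuclideanSpace ℝ (Fin d)}
    {L : Finset (EuclideanSpace ℝ (Fin d) × ℝ)} (hG : IsAdapted (Φ.V (k + 1)) c L G)
    {ε : ℝ} (hε : 0 < ε) (M : ℝ) :
    ∃ T : ℝ, ∀ ξ : EuclideanSpace ℝ (Fin d), ‖(Φ.V k).orthogonalProjectionOnto ξ‖ ≤ M →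
      T ≤ |(inner ℝ ξ (u k) : ℝ)| →
      ‖normalFactor ξ (u k) * pieceIntegral (k + 1) G ξ -
        ∑ᶠ H ∈ facets Φ k G, (facetSign Φ k G H : ℂ) * pieceIntegral k H ξ‖ ≤ ε := by
  obtain ⟨hn, hpos⟩ := hu k hk hkd
  obtain ⟨T, hT⟩ := exists_norm_mul_pieceIntegral_sub_le (Φ.finrank_eq k hk hkd.le)
    (Φ.finrank_eq (k + 1) (by omega) (by omega)) hG hn hε M
  refine ⟨T, fun ξ h1 h2 => ?_⟩
  have e := finsum_mem_facets hG hn (fun H => pieceIntegral k H ξ) (pieceIntegral_empty k ξ)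
  have e2 : ∑ᶠ H ∈ facets Φ k G, (facetSign Φ k G H : ℂ) * pieceIntegral k H ξ =
      ∑ᶠ H ∈ facets Φ k G, (if IsFacet (Φ.V k) (halfSpace (Φ.V (k + 1)) (u k)) G H then 1 else -1) *
        pieceIntegral k H ξ := by
    refine finsum_mem_congr rfl fun H _ => ?_
    rw [facetSign, hpos]
    split_ifs <;> simp
  rw [e2, facets, hu.neg_eq hk hkd, hpos, e]
  exact hT ξ h1 h2

theorem abs_facetSign (k : ℕ) (G H : Set (EuclideanSpace ℝ (Fin d))) :
    |facetSign Φ k G H| = 1 := by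
  unfold facetSign
  split_ifs <;> simp

/-- Along lacunary frequencies the Fourier integral of `G`, multiplied by the normal factors,
is asymptotically the signed sum over the sequences of faces of `G`. -/
theorem finite_sequencesTo_and_asymptotics {u : ℕ → EuclideanSpace ℝ (Fin d)} (hu : IsNormals Φ u)
    {k : ℕ} (hk : r ≤ k) (hkd : k ≤ d) :
    ∀ (c : EuclideanSpace ℝ (Fin d)) (L : Finset (EuclideanSpace ℝ (Fin d) × ℝ))
      (G : Set (EuclideanSpace ℝ (Fin d))), IsAdapted (Φ.V k) c L G →
    (sequencesTo Φ k G).Finite ∧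
    (∀ F ∈ sequencesTo Φ k G, ∃ c' L', IsAdapted (Φ.V r) c' L' (F r)) ∧
    ∀ ε : ℝ, 0 < ε → ∃ T : ℝ → ℝ, ∀ ξ, IsLacunary Φ u T k ξ →
      ‖(∏ j ∈ Finset.Ico r k, normalFactor ξ (u j)) * pieceIntegral k G ξ - faceSum Φ k G ξ‖ ≤
        ε := by
  induction k, hk using Nat.le_induction with
  | base =>
    intro c L G hG
    rw [sequencesTo_self]
    refine ⟨Set.finite_singleton _, ?_, fun ε hε => ⟨0, fun ξ _ => ?_⟩⟩
    · rintro F rfl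
      simp only [lt_self_iff_false, if_false]
      exact ⟨c, L, hG⟩
    · rw [faceSum_self]
      simpa using hε.le
  | succ k hk ih =>
    intro c L G hG
    have ih := ih (by omega)
    have hkd' : k < d := by omega
    have hfin := facets_finite hu hk hkd' hG
    have hfac := fun H hH => isAdapted_of_mem_facets hu hk hkd' (H := H) hG hH
    have hseq : ∀ H ∈ facets Φ k G, (sequencesTo Φ k H).Finite := fun H hH => by
      obtain ⟨x, hx⟩ := hfac H hH
      exact (ih _ _ _ hx).1
    refine ⟨?_, ?_, fun ε hε => ?_⟩
    · rw [sequencesTo_succ hk]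
      exact hfin.biUnion fun H hH => (hseq H hH).image _
    · rw [sequencesTo_succ hk]
      intro F hF
      simp only [Set.mem_iUnion, Set.mem_image] at hF
      obtain ⟨H, hH, F, hF, rfl⟩ := hF
      obtain ⟨x, hx⟩ := hfac H hH
      rw [extendSequence_of_le hk]
      exact (ih _ _ _ hx).2.1 F hF
    · set N := hfin.toFinset.card
      have hδ : 0 < ε / (2 * (N + 1)) := by positivity
      have h1 : ∀ H, ∃ T : ℝ → ℝ, H ∈ facets Φ k G → ∀ ξ, IsLacunary Φ u T k ξ →
          ‖(∏ j ∈ Finset.Ico r k, normalFactor ξ (u j)) * pieceIntegral k H ξ -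
            faceSum Φ k H ξ‖ ≤ ε / (2 * (N + 1)) := by
        intro H
        by_cases hH : H ∈ facets Φ k G
        · obtain ⟨x, hx⟩ := hfac H hH
          obtain ⟨T, hT⟩ := (ih _ _ _ hx).2.2 _ hδ
          exact ⟨T, fun _ => hT⟩
        · exact ⟨0, fun h => absurd h hH⟩
      choose T hT using h1
      -- The error of the top step gets multiplied by the lower normal factors, so its tolerance is
      -- divided in advance by their bound.
      have h2 : ∀ M : ℝ, 0 < ε / (2 * ((2 * Real.pi * |M|) ^ (k - r) + 1)) := fun M => by
        positivity
      have h3 := fun M => exists_norm_normalFactor_mul_sub_le hu hk hkd' hG (h2 M) M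
      choose S hS using h3
      refine ⟨fun M => |S M| + ∑ H ∈ hfin.toFinset, |T H M|, fun ξ hξ => ?_⟩
      have hξT : ∀ H ∈ facets Φ k G, IsLacunary Φ u (T H) k ξ := fun H hH => by
        refine hξ.mono (fun M => ?_) (Nat.le_succ k)
        have : |T H M| ≤ ∑ H ∈ hfin.toFinset, |T H M| :=
          Finset.single_le_sum (f := fun H => |T H M|) (fun _ _ => abs_nonneg _)
          (hfin.mem_toFinset.2 hH)
        have h0 := abs_nonneg (S M)
        have h4 := le_abs_self (T H M)
        linarith
      obtain ⟨M, hM, hSM⟩ := hξ k hk (Nat.lt_succ_self k)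
      have hS' := hS M ξ hM (by
        have h0 : 0 ≤ ∑ H ∈ hfin.toFinset, |T H M| := Finset.sum_nonneg fun _ _ => abs_nonneg _
        have h4 := le_abs_self (S M)
        linarith)
      have hP := norm_prod_normalFactor_le hu hkd'.le hM
      rw [faceSum_succ hk hfin hseq, finsum_mem_eq_finite_toFinset_sum _ hfin,
        Finset.prod_Ico_succ_top hk]
      rw [finsum_mem_eq_finite_toFinset_sum _ hfin] at hS'
      set P := ∏ j ∈ Finset.Ico r k, normalFactor ξ (u j)
      -- The total error is the error of the top step times `P`, plus the signed errors of the
      -- induction hypothesis on the facets; each part receives `ε / 2`.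
      have e : P * normalFactor ξ (u k) * pieceIntegral (k + 1) G ξ -
          ∑ H ∈ hfin.toFinset, (facetSign Φ k G H : ℂ) * faceSum Φ k H ξ =
          P * (normalFactor ξ (u k) * pieceIntegral (k + 1) G ξ -
            ∑ H ∈ hfin.toFinset, (facetSign Φ k G H : ℂ) * pieceIntegral k H ξ) +
          ∑ H ∈ hfin.toFinset, (facetSign Φ k G H : ℂ) *
            (P * pieceIntegral k H ξ - faceSum Φ k H ξ) := by
        rw [mul_sub, Finset.mul_sum]
        simp only [mul_sub, Finset.sum_sub_distrib]
        rw [Finset.sum_congr rfl fun H _ => mul_left_comm P (facetSign Φ k G H : ℂ) _]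
        ring
      rw [e]
      refine (norm_add_le _ _).trans ?_
      rw [← add_halves ε]
      refine add_le_add ?_ ?_
      · rw [norm_mul]
        refine (mul_le_mul hP hS' (norm_nonneg _) (by positivity)).trans ?_
        rw [mul_div_assoc', div_le_div_iff₀ (by positivity) (by positivity)]
        have : 0 ≤ (2 * Real.pi * |M|) ^ (k - r) := by positivity
        nlinarith
      · refine (norm_sum_le_of_le (f := fun H => (facetSign Φ k G H : ℂ) *
            (P * pieceIntegral k H ξ - faceSum Φ k H ξ)) (n := fun _ => ε / (2 * (N + 1)))
            hfin.toFinset fun H hH => ?_).trans ?_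
        · rw [norm_mul, Complex.norm_real, Real.norm_eq_abs, abs_facetSign, one_mul]
          have hH' := hfin.mem_toFinset.1 hH
          exact hT H hH' ξ (hξT H hH')
        · rw [Finset.sum_const, nsmul_eq_mul]
          change (N : ℝ) * _ ≤ _
          rw [mul_div_assoc', div_le_div_iff₀ (by positivity) (by positivity)]
          nlinarith

end Flag

/-! ### Polytopes as adapted sets -/

section Polytope

variable {d : ℕ}

/-- A simplex of full dimension is given by non-negativity of finitely many non-constant affine
functions. -/
theorem exists_affineEval_convexHull_simplex (hd : 0 < d)
    (S : Affine.Simplex ℝ (EuclideanSpace ℝ (Fin d)) d) :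
    ∃ L : Finset (EuclideanSpace ℝ (Fin d) × ℝ), (∀ l ∈ L, ∃ w, (inner ℝ l.1 w : ℝ) ≠ 0) ∧
      (∀ x, x ∈ convexHull ℝ (Set.range S.points) ↔ ∀ l ∈ L, 0 ≤ affineEval l x) := by
  classical
  have htop : affineSpan ℝ (Set.range S.points) = ⊤ := by
    rw [S.independent.affineSpan_eq_top_iff_card_eq_finrank_add_one]
    simp
  let b : AffineBasis (Fin (d + 1)) ℝ (EuclideanSpace ℝ (Fin d)) := ⟨S.points, S.independent, htop⟩
  -- The functions are the barycentric coordinates, split into gradient and value at the origin.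
  let l : Fin (d + 1) → EuclideanSpace ℝ (Fin d) × ℝ := fun i =>
    ((InnerProductSpace.toDual ℝ _).symm (LinearMap.toContinuousLinearMap (b.coord i).linear),
      b.coord i 0)
  have hinner : ∀ i w, (inner ℝ (l i).1 w : ℝ) = (b.coord i).linear w := fun i w => by
    simp [l, InnerProductSpace.toDual_symm_apply]
  have hl : ∀ i x, affineEval (l i) x = b.coord i x := fun i x => by
    rw [affineEval, hinner]
    have := (b.coord i).linearMap_vsub x 0
    simp only [vsub_eq_sub, sub_zero] at this
    rw [this]
    simp [l]
  refine ⟨Finset.univ.image l, ?_, fun x => ?_⟩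
  · intro l' hl'
    obtain ⟨i, -, rfl⟩ := Finset.mem_image.1 hl'
    have : Nontrivial (Fin (d + 1)) := Fin.nontrivial_iff_two_le.2 (by omega)
    obtain ⟨j, hj⟩ := exists_ne i
    refine ⟨b i - b j, ?_⟩
    rw [hinner]
    have := (b.coord i).linearMap_vsub (b i) (b j)
    simp only [vsub_eq_sub] at this
    rw [this, b.coord_apply_eq, b.coord_apply_ne hj.symm]
    norm_num
  · change x ∈ convexHull ℝ (Set.range b) ↔ _
    rw [b.convexHull_eq_nonneg_coord]
    simp [hl]

theorem interior_convexHull_simplex_nonempty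
    (S : Affine.Simplex ℝ (EuclideanSpace ℝ (Fin d)) d) :
    (interior (convexHull ℝ (Set.range S.points))).Nonempty := by
  rw [interior_convexHull_nonempty_iff_affineSpan_eq_top,
    S.independent.affineSpan_eq_top_iff_card_eq_finrank_add_one]
  simp

theorem IsPolytope.isClosed {A : Set (EuclideanSpace ℝ (Fin d))} (hA : IsPolytope A) :
    IsClosed A := by
  obtain ⟨N, S, -, rfl⟩ := hA
  exact isClosed_iUnion_of_finite fun i => (Set.finite_range (S i).points).isClosed_convexHull ℝ

/-- The barycentric coordinates of all the simplices serve. Each simplex is the closure of its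
interior, where generic points are dense. -/
theorem IsPolytope.exists_isAdapted (hd : 0 < d) {A : Set (EuclideanSpace ℝ (Fin d))}
    (hA : IsPolytope A) : ∃ L, IsAdapted ⊤ 0 L A := by
  classical
  have hcl := hA.isClosed
  obtain ⟨N, S, -, rfl⟩ := hA
  choose L hL1 hL2 using fun i => exists_affineEval_convexHull_simplex hd (S i)
  have hne : ∀ l ∈ Finset.univ.biUnion L, ∃ w ∈ (⊤ : Submodule ℝ (EuclideanSpace ℝ (Fin d))),
      (inner ℝ l.1 w : ℝ) ≠ 0 := by
    intro l hl
    obtain ⟨i, -, hi⟩ := Finset.mem_biUnion.1 hl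
    obtain ⟨w, hw⟩ := hL1 i l hi
    exact ⟨w, Submodule.mem_top, hw⟩
  refine ⟨Finset.univ.biUnion L, hcl, ?_, fun _ _ => Submodule.mem_top, hne, ?_, ?_⟩
  · rw [Bornology.isBounded_iUnion]
    exact fun i => (isBounded_convexHull).2 (Set.finite_range _).isBounded
  · intro y z _ _ h
    simp only [Set.mem_iUnion, hL2]
    refine exists_congr fun i => forall₂_congr fun l hl => ?_
    have := h l (Finset.mem_biUnion.2 ⟨i, Finset.mem_univ _, hl⟩)
    rcases pos_and_pos_or_neg_and_neg_of_mul_pos this with h' | h'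
    · exact iff_of_true h'.1.le h'.2.le
    · exact iff_of_false h'.1.not_ge h'.2.not_ge
  · refine Set.iUnion_subset fun i => ?_
    have hconv := convex_convexHull ℝ (Set.range (S i).points)
    refine subset_closure.trans ?_
    rw [← hconv.closure_interior_eq_closure_of_nonempty_interior
      (interior_convexHull_simplex_nonempty (S i))]
    refine closure_minimal (fun y hy => ?_) isClosed_closure
    rw [mem_closure_iff_frequently]
    refine ((frequently_affineEval_ne_zero (Finset.univ.biUnion L) hne y).and_eventually
      (isOpen_interior.mem_nhds hy)).mono fun z hz => ⟨?_, hz.1.2⟩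
    exact Set.mem_iUnion.2 ⟨i, interior_subset hz.2⟩

theorem IsPolytope.interior_nonempty {A : Set (EuclideanSpace ℝ (Fin d))} (hA : IsPolytope A)
    (h : A.Nonempty) : (interior A).Nonempty := by
  obtain ⟨N, S, -, rfl⟩ := hA
  obtain ⟨x, hx⟩ := h
  obtain ⟨i, -⟩ := Set.mem_iUnion.1 hx
  exact (interior_convexHull_simplex_nonempty (S i)).mono
    (interior_mono (Set.subset_iUnion (fun i => convexHull ℝ (Set.range (S i).points)) i))

end Polytope

/-! ### Parseval's identity and relative density of the spectrum -/

section Spectrum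

variable {d : ℕ} {A Λ : Set (EuclideanSpace ℝ (Fin d))}

theorem star_expo (ξ x : EuclideanSpace ℝ (Fin d)) :
    (starRingEnd ℂ) (expo ξ x) = expo (-ξ) x := by
  rw [expo, expo, ← Complex.exp_conj, inner_neg_left]
  congr 1
  simp only [map_mul, map_ofNat, Complex.conj_ofReal, Complex.conj_I, Complex.ofReal_neg]
  ring

theorem expo_add_left (ξ η x : EuclideanSpace ℝ (Fin d)) :
    expo (ξ + η) x = expo ξ x * expo η x := by
  rw [expo, inner_add_left, Complex.ofReal_add, mul_add, Complex.exp_add, expo, expo]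

theorem IsSpectrum.integral_expo_sub_eq_zero (hΛ : IsSpectrum Λ A)
    {ξ η : EuclideanSpace ℝ (Fin d)} (hξ : ξ ∈ Λ) (hη : η ∈ Λ) (h : ξ ≠ η) :
    ∫ x in A, expo (ξ - η) x = 0 := by
  rw [← hΛ.2.1 ξ hξ η hη h]
  congr 1
  ext x
  rw [star_expo, ← expo_add_left, sub_eq_add_neg]

theorem memLp_expo [IsFiniteMeasure (volume.restrict A)] (ξ : EuclideanSpace ℝ (Fin d)) :
    MemLp (expo ξ) 2 (volume.restrict A) :=
  MemLp.of_bound (continuous_expo ξ).aestronglyMeasurable 1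
    (Eventually.of_forall fun x => (norm_expo ξ x).le)

theorem inner_toLp {μ : Measure (EuclideanSpace ℝ (Fin d))}
    {f g : EuclideanSpace ℝ (Fin d) → ℂ} (hf : MemLp f 2 μ) (hg : MemLp g 2 μ) :
    inner ℂ (hf.toLp f) (hg.toLp g) = ∫ x, (starRingEnd ℂ) (f x) * g x ∂μ := by
  rw [L2.inner_def]
  refine integral_congr_ae ?_
  filter_upwards [hf.coeFn_toLp, hg.coeFn_toLp] with x h1 h2
  rw [h1, h2, RCLike.inner_apply, mul_comm]

/-- Parseval's identity for a spectrum. -/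
theorem IsSpectrum.hasSum_sq_norm (hΛ : IsSpectrum Λ A) [IsFiniteMeasure (volume.restrict A)]
    (hA : 0 < volume.real A) {f : EuclideanSpace ℝ (Fin d) → ℂ}
    (hf : MemLp f 2 (volume.restrict A)) :
    HasSum (fun ξ : Λ => ‖∫ x in A, expo (-(ξ : EuclideanSpace ℝ (Fin d))) x * f x‖ ^ 2)
      (volume.real A * ∫ x in A, ‖f x‖ ^ 2) := by
  set m := volume.real A with hm
  set e : EuclideanSpace ℝ (Fin d) → Lp ℂ 2 (volume.restrict A) :=
    fun ξ => (memLp_expo ξ).toLp (expo ξ) with he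
  have hinner : ∀ (ξ : EuclideanSpace ℝ (Fin d)) {g : EuclideanSpace ℝ (Fin d) → ℂ}
      (hg : MemLp g 2 (volume.restrict A)),
      inner ℂ (e ξ) (hg.toLp g) = ∫ x in A, expo (-ξ) x * g x := fun ξ g hg => by
    rw [he, inner_toLp]
    simp only [star_expo]
  have hself : ∀ ξ, inner ℂ (e ξ) (e ξ) = (m : ℂ) := fun ξ => by
    rw [hinner]
    simp only [← expo_add_left, neg_add_cancel]
    simp [expo, hm]
  have hsq : (Real.sqrt m : ℂ) * Real.sqrt m = m := by
    rw [← Complex.ofReal_mul, Real.mul_self_sqrt hA.le]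
  have hs0 : (Real.sqrt m : ℂ) ≠ 0 := by
    exact_mod_cast (Real.sqrt_pos.2 hA).ne'
  set v : Λ → Lp ℂ 2 (volume.restrict A) := fun ξ => ((Real.sqrt m : ℂ)⁻¹) • e ξ with hv
  have hinnerv : ∀ (ξ : Λ) (x : Lp ℂ 2 (volume.restrict A)),
      inner ℂ (v ξ) x = (Real.sqrt m : ℂ)⁻¹ * inner ℂ (e ξ) x := fun ξ x => by
    rw [hv]
    simp only
    rw [inner_smul_left]
    simp
  have hon : Orthonormal ℂ v := by
    classical
    rw [orthonormal_iff_ite]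
    intro ξ η
    rw [hinnerv]
    simp only [hv]
    rw [inner_smul_right]
    split_ifs with h
    · subst h
      rw [hself, ← hsq]
      field_simp
    · have : inner ℂ (e ξ) (e η) = (0 : ℂ) := by
        rw [hinner]
        simp only [← expo_add_left]
        rw [neg_add_eq_sub]
        exact hΛ.integral_expo_sub_eq_zero η.2 ξ.2 fun h' => h (Subtype.ext h'.symm)
      rw [this, mul_zero, mul_zero]
  -- Completeness is given for functions; this carries it over to classes in `L²`.
  have hspan : ∀ g ∈ Submodule.span ℂ (expo '' Λ), ∃ hg : MemLp g 2 (volume.restrict A),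
      hg.toLp g ∈ Submodule.span ℂ (Set.range v) := by
    intro g hg
    induction hg using Submodule.span_induction with
    | mem g hg =>
      obtain ⟨ξ, hξ, rfl⟩ := hg
      refine ⟨memLp_expo ξ, ?_⟩
      have : (memLp_expo ξ).toLp (expo ξ) = (Real.sqrt m : ℂ) • v ⟨ξ, hξ⟩ := by
        simp only [hv, he]
        rw [smul_smul, mul_inv_cancel₀ hs0, one_smul]
      rw [this]
      exact Submodule.smul_mem _ _ (Submodule.subset_span ⟨_, rfl⟩)
    | zero => exact ⟨MemLp.zero, by rw [MemLp.toLp_zero]; exact Submodule.zero_mem _⟩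
    | add g h _ _ ihg ihh =>
      obtain ⟨hg, hg'⟩ := ihg
      obtain ⟨hh, hh'⟩ := ihh
      exact ⟨hg.add hh, by rw [hg.toLp_add hh]; exact Submodule.add_mem _ hg' hh'⟩
    | smul a g _ ih =>
      obtain ⟨hg, hg'⟩ := ih
      exact ⟨hg.const_smul a, by
        rw [hg.toLp_const_smul a]; exact Submodule.smul_mem _ _ hg'⟩
  have htop : ⊤ ≤ (Submodule.span ℂ (Set.range v)).topologicalClosure := by
    intro F _
    rw [← SetLike.mem_coe, Submodule.topologicalClosure_coe, Metric.mem_closure_iff]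
    intro ε hε
    obtain ⟨g, hg, hlt⟩ := hΛ.2.2 F (Lp.memLp F) ε hε
    obtain ⟨hg', hmem⟩ := hspan g hg
    refine ⟨_, hmem, ?_⟩
    rw [dist_eq_norm]
    have : F - hg'.toLp g = ((Lp.memLp F).sub hg').toLp (⇑F - g) := by
      rw [MemLp.toLp_sub (Lp.memLp F) hg', Lp.toLp_coeFn]
    rw [this, Lp.norm_toLp]
    exact ENNReal.toReal_lt_of_lt_ofReal hlt
  let b := HilbertBasis.mk hon htop
  have hb : ∀ ξ, b ξ = v ξ := fun ξ => by rw [HilbertBasis.coe_mk]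
  have h1 := b.hasSum_inner_mul_inner (hf.toLp f) (hf.toLp f)
  have h2 : ∀ ξ : Λ, inner ℂ (hf.toLp f) (b ξ) * inner ℂ (b ξ) (hf.toLp f) =
      ((m⁻¹ * ‖∫ x in A, expo (-(ξ : EuclideanSpace ℝ (Fin d))) x * f x‖ ^ 2 : ℝ) : ℂ) := by
    intro ξ
    rw [← inner_conj_symm, hb, hinnerv, hinner, ← Complex.normSq_eq_conj_mul_self,
      Complex.normSq_eq_norm_sq, norm_mul, mul_pow, norm_inv, Complex.norm_real, Real.norm_eq_abs,
      abs_of_nonneg (Real.sqrt_nonneg _), inv_pow, Real.sq_sqrt hA.le]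
  have h3 : inner ℂ (hf.toLp f) (hf.toLp f) = ((∫ x in A, ‖f x‖ ^ 2 : ℝ) : ℂ) := by
    rw [inner_toLp, ← integral_complex_ofReal]
    refine integral_congr_ae (Eventually.of_forall fun x => ?_)
    simp only
    rw [← Complex.normSq_eq_conj_mul_self, Complex.normSq_eq_norm_sq]
  simp only [h2, h3] at h1
  have h4 := (Complex.hasSum_ofReal.1 h1).mul_left m
  simpa only [mul_inv_cancel_left₀ hA.ne'] using h4

theorem fderiv_expo (ξ x v : EuclideanSpace ℝ (Fin d)) :
    DifferentiableAt ℝ (expo ξ) x ∧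
    fderiv ℝ (expo ξ) x v = (2 * Real.pi * Complex.I * ((inner ℝ ξ v : ℝ) : ℂ)) * expo ξ x := by
  have h1 : HasFDerivAt (fun x => ((inner ℝ ξ x : ℝ) : ℂ))
      (Complex.ofRealCLM.comp (innerSL ℝ ξ)) x :=
    (Complex.ofRealCLM.comp (innerSL ℝ ξ)).hasFDerivAt
  have h2 := (h1.const_mul (2 * Real.pi * Complex.I)).cexp
  refine ⟨h2.differentiableAt, ?_⟩
  have : fderiv ℝ (expo ξ) x = _ := h2.fderiv
  rw [this]
  simp [expo]
  ring

/-- The spectrum is relatively dense. -/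
theorem IsSpectrum.exists_norm_sub_le (hΛ : IsSpectrum Λ A) (hb : Bornology.IsBounded A)
    (hint : (interior A).Nonempty) :
    ∃ R : ℝ, ∀ x, ∃ ξ ∈ Λ, ‖ξ - x‖ ≤ R := by
  have hfin : volume A < ⊤ := hb.measure_lt_top
  have : IsFiniteMeasure (volume.restrict A) := ⟨by simpa using hfin⟩
  obtain ⟨c, hc⟩ := hint
  have hA : 0 < volume.real A := by
    refine ENNReal.toReal_pos (fun h => ?_) hfin.ne
    exact (isOpen_interior.measure_pos volume ⟨c, hc⟩).ne'
      (measure_mono_null interior_subset h)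
  set m := volume.real A
  obtain ⟨ρ, hρ, hball⟩ := Metric.isOpen_iff.1 isOpen_interior c hc
  -- A bump function supported inside `A`, so that integration by parts over `A` has no boundary
  -- terms.
  let φ : ContDiffBump c := ⟨ρ / 4, ρ / 2, by positivity, by linarith⟩
  set f : EuclideanSpace ℝ (Fin d) → ℂ := fun x => ((φ x : ℝ) : ℂ) with hf
  have hsupp : tsupport f ⊆ A := by
    have h1 : tsupport f ⊆ tsupport φ := by
      refine closure_mono fun x hx => ?_
      intro h
      exact hx (by simp [hf, h])
    refine h1.trans ?_
    rw [φ.tsupport_eq]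
    refine (Metric.closedBall_subset_ball ?_).trans (hball.trans interior_subset)
    change ρ / 2 < ρ
    linarith
  have hfC : ContDiff ℝ 1 f := Complex.ofRealCLM.contDiff.comp φ.contDiff
  have hfcs : HasCompactSupport f := φ.hasCompactSupport.comp_left (g := Complex.ofReal) rfl
  have hdC : ∀ v, Continuous fun x => fderiv ℝ f x v := fun v =>
    (hfC.continuous_fderiv one_ne_zero).clm_apply continuous_const
  have hdcs : ∀ v, HasCompactSupport fun x => fderiv ℝ f x v := fun v =>
    hfcs.fderiv_apply ℝ v
  have hdsupp : ∀ v, ∀ x ∉ A, fderiv ℝ f x v = 0 := fun v x hx => by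
    have : fderiv ℝ f x = 0 := by
      by_contra h
      exact hx (hsupp (support_fderiv_subset ℝ h))
    rw [this]; rfl
  have hfsupp : ∀ x ∉ A, f x = 0 := fun x hx => by
    by_contra h
    exact hx (hsupp (subset_tsupport f h))
  have hset : ∀ g : EuclideanSpace ℝ (Fin d) → ℂ, (∀ x ∉ A, g x = 0) →
      ∀ ξ, ∫ x in A, expo ξ x * g x = ∫ x, expo ξ x * g x := fun g hg ξ =>
    setIntegral_eq_integral_of_forall_compl_eq_zero fun x hx => by rw [hg x hx, mul_zero]
  have hderiv : ∀ ξ v, ∫ x in A, expo ξ x * fderiv ℝ f x v =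
      -((2 * Real.pi * Complex.I * ((inner ℝ ξ v : ℝ) : ℂ)) * ∫ x in A, expo ξ x * f x) := by
    intro ξ v
    rw [hset _ (hdsupp v), hset _ hfsupp, ← integral_const_mul,
      integral_mul_fderiv_eq_neg_fderiv_mul_of_integrable]
    · congr 2
      ext x
      rw [(fderiv_expo ξ x v).2]
      ring
    · simp only [(fderiv_expo ξ _ v).2]
      refine Continuous.integrable_of_hasCompactSupport ?_ hfcs.mul_left
      have := continuous_expo ξ
      have := hfC.continuous
      fun_prop
    · exact ((continuous_expo ξ).mul (hdC v)).integrable_of_hasCompactSupport (hdcs v).mul_left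
    · exact ((continuous_expo ξ).mul hfC.continuous).integrable_of_hasCompactSupport hfcs.mul_left
    · exact fun x _ => (fderiv_expo ξ x v).1
    · exact fun x _ => hfC.differentiable one_ne_zero x
  -- Parseval for `e_x g`: the sum does not depend on `x`.
  have hmod : ∀ (g : EuclideanSpace ℝ (Fin d) → ℂ), Continuous g → HasCompactSupport g →
      ∀ x : EuclideanSpace ℝ (Fin d),
      HasSum (fun ξ : Λ => ‖∫ y in A, expo (x - (ξ : EuclideanSpace ℝ (Fin d))) y * g y‖ ^ 2)
        (m * ∫ y in A, ‖g y‖ ^ 2) := by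
    intro g hg hgs x
    have h := hΛ.hasSum_sq_norm hA (f := fun y => expo x y * g y)
      (((continuous_expo x).mul hg).memLp_of_hasCompactSupport hgs.mul_left)
    simp only [norm_mul, norm_expo, one_mul, ← mul_assoc, ← expo_add_left] at h
    simpa only [neg_add_eq_sub] using h
  set e : Fin d → EuclideanSpace ℝ (Fin d) := fun i => EuclideanSpace.single i 1
  set C : ℝ := ∑ i, m * ∫ y in A, ‖fderiv ℝ f y (e i)‖ ^ 2
  set I : ℝ := m * ∫ y in A, ‖f y‖ ^ 2
  have hIpos : 0 < I := by
    refine mul_pos hA ?_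
    rw [setIntegral_eq_integral_of_forall_compl_eq_zero fun x hx => by rw [hfsupp x hx]; simp]
    refine Continuous.integral_pos_of_hasCompactSupport_nonneg_nonzero (x := c) ?_ ?_ ?_ ?_
    · have := hfC.continuous
      fun_prop
    · exact hfcs.comp_left (g := fun z : ℂ => ‖z‖ ^ 2) (by simp)
    · exact fun x => by positivity
    · simp [hf, φ.one_of_mem_closedBall (Metric.mem_closedBall_self φ.rIn_pos.le)]
  -- Adding Parseval for all partial derivatives puts the weight `(2π‖x - ξ‖)²` on the terms, again
  -- with a sum independent of `x`.
  have hsum : ∀ x : EuclideanSpace ℝ (Fin d), HasSum (fun ξ : Λ => (2 * Real.pi * ‖x - (ξ : EuclideanSpace ℝ (Fin d))‖) ^ 2 *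
      ‖∫ y in A, expo (x - (ξ : EuclideanSpace ℝ (Fin d))) y * f y‖ ^ 2) C := by
    intro x
    have h := hasSum_sum (s := Finset.univ) fun i _ => hmod _ (hdC (e i)) (hdcs (e i)) x
    convert h using 2 with ξ
    rw [mul_pow, EuclideanSpace.real_norm_sq_eq, Finset.mul_sum, Finset.sum_mul]
    refine Finset.sum_congr rfl fun i _ => ?_
    have hn : ‖(2 * Real.pi * Complex.I *
        ((inner ℝ (x - (ξ : EuclideanSpace ℝ (Fin d))) (e i) : ℝ) : ℂ))‖ =
        2 * Real.pi * |(x - (ξ : EuclideanSpace ℝ (Fin d))) i| := by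
      simp only [norm_mul, Complex.norm_real, Real.norm_eq_abs, Complex.norm_ofNat, Complex.norm_I,
        abs_of_pos Real.pi_pos, mul_one, e, EuclideanSpace.inner_single_right, conj_trivial, one_mul]
    rw [hderiv, norm_neg, norm_mul, hn, ← sq_abs ((x - (ξ : EuclideanSpace ℝ (Fin d))) i)]
    ring
  have hCnn : 0 ≤ C := (hsum 0).nonneg fun _ => by positivity
  refine ⟨Real.sqrt (C / I) + 1, fun x => ?_⟩
  by_contra! hx
  set R := Real.sqrt (C / I) + 1
  -- If every point of the spectrum were farther than `R` from `x`, comparing the two sums would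
  -- give `R² I ≤ C`.
  have hR : C < R ^ 2 * I := by
    have h0 := Real.sqrt_nonneg (C / I)
    have h1 : C / I < R ^ 2 := by
      have := Real.sq_sqrt (div_nonneg hCnn hIpos.le)
      change C / I < (Real.sqrt (C / I) + 1) ^ 2
      nlinarith
    exact (div_lt_iff₀ hIpos).1 h1
  have h1 := (hmod f hfC.continuous hfcs x).mul_left (R ^ 2)
  have h2 := hasSum_le (fun ξ : Λ => ?_) h1 (hsum x)
  · exact absurd h2 (not_le.2 hR)
  · have := (hx ξ ξ.2).le
    rw [norm_sub_rev] at this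
    have h3 : R ≤ 2 * Real.pi * ‖x - (ξ : EuclideanSpace ℝ (Fin d))‖ := by
      have := Real.pi_gt_three
      have := norm_nonneg (x - (ξ : EuclideanSpace ℝ (Fin d)))
      nlinarith
    have h0 : 0 ≤ R := by positivity
    gcongr

end Spectrum

/-! ### Lacunary frequencies and almost periods -/

section Main

variable {d r : ℕ}

theorem orthogonalProjectionOnto_eq_zero_of_inner {V : Submodule ℝ (EuclideanSpace ℝ (Fin d))}
    {u : EuclideanSpace ℝ (Fin d)} (h : ∀ v ∈ V, (inner ℝ u v : ℝ) = 0) :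
    V.orthogonalProjectionOnto u = 0 := by
  refine ext_inner_right ℝ fun w => ?_
  rw [inner_orthogonalProjectionOnto, inner_zero_left]
  exact h _ w.2

/-- Every ball of a given radius has a translate, in a direction normal to the lowest subspace of
the flag, that consists of lacunary frequencies. -/
theorem exists_forall_norm_sub_le_isLacunary {Φ : RFlag d r} {u : ℕ → EuclideanSpace ℝ (Fin d)}
    (hu : IsNormals Φ u) (T : ℝ → ℝ) (B : ℝ) {k : ℕ} (hk : r ≤ k) (hkd : k ≤ d) :
    ∃ p ∈ Φ.V k, (Φ.V r).orthogonalProjectionOnto p = 0 ∧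
      ∀ ξ, ‖ξ - p‖ ≤ B → IsLacunary Φ u T k ξ := by
  induction k, hk using Nat.le_induction with
  | base =>
    exact ⟨0, Submodule.zero_mem _, map_zero _, fun ξ _ j h1 h2 => absurd h2 h1.not_gt⟩
  | succ k hk ih =>
    obtain ⟨p, hpV, hp0, hp⟩ := ih (by omega)
    have hn := (hu k hk (by omega)).1
    have hproj : ∀ j, r ≤ j → j ≤ k → (Φ.V j).orthogonalProjectionOnto (u k) = 0 :=
      fun j hj hjk => orthogonalProjectionOnto_eq_zero_of_inner fun v hv =>
        hn.inner_eq v (Φ.mono hj hjk (by omega) hv)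
    -- A move along `u k` affects neither the projections to `V j` with `j ≤ k` nor the products
    -- with lower normals. The size of `t` meets the threshold for `M = ‖p‖ + B` even after a
    -- perturbation of norm `B`.
    set t : ℝ := |T (‖p‖ + B)| + B with ht
    refine ⟨p + t • u k, hn.add_smul_mem hpV t, ?_, fun ξ hξ j hj hjk => ?_⟩
    · rw [map_add, map_smul, hproj r le_rfl hk, hp0, smul_zero, add_zero]
    · have hPj : ∀ i, r ≤ i → i ≤ k → (Φ.V i).orthogonalProjectionOnto ξ =
          (Φ.V i).orthogonalProjectionOnto (ξ - t • u k) := fun i hi hik => by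
        rw [map_sub, map_smul, hproj i hi hik, smul_zero, sub_zero]
      rcases (Nat.lt_succ_iff.1 hjk).lt_or_eq with hlt | rfl
      · obtain ⟨M, hM, hTM⟩ := hp (ξ - t • u k) (by rwa [sub_sub, add_comm]) j hj hlt
        refine ⟨M, by rwa [hPj j hj hlt.le], ?_⟩
        have huj : (inner ℝ (u k) (u j) : ℝ) = 0 :=
          hn.inner_eq _ (Φ.mono (by omega) (Nat.succ_le_of_lt hlt) (by omega)
            (hu j hj (by omega)).1.mem)
        rwa [inner_sub_left, real_inner_smul_left, huj, mul_zero, sub_zero] at hTM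
      · refine ⟨‖p‖ + B, ?_, ?_⟩
        · rw [hPj j hj le_rfl]
          refine (Submodule.norm_orthogonalProjectionOnto_apply_le _ _).trans ?_
          have : ξ - t • u j = p + (ξ - (p + t • u j)) := by abel
          rw [this]
          exact (norm_add_le _ _).trans (by gcongr)
        · have e : (inner ℝ ξ (u j) : ℝ) = inner ℝ (ξ - (p + t • u j)) (u j) + t := by
            rw [inner_sub_left, inner_add_left, real_inner_smul_left, hn.inner_self,
              real_inner_comm (u j) p, hn.inner_eq p hpV]
            ring
          have h1 := abs_real_inner_le_norm (ξ - (p + t • u j)) (u j)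
          rw [hn.norm_eq, mul_one] at h1
          have h2 := (abs_le.1 (h1.trans hξ)).1
          refine le_trans ?_ (le_abs_self _)
          rw [e, ht]
          linarith [le_abs_self (T (‖p‖ + B))]

/-- On `c + V` the exponential is the phase at `c` times a character of the projection of `ξ`. Both
tend to `1`, and dominated convergence applies. -/
theorem tendsto_pieceIntegral {V : Submodule ℝ (EuclideanSpace ℝ (Fin d))} {k : ℕ}
    (hk : Module.finrank ℝ V = k) {c : EuclideanSpace ℝ (Fin d)} {H : Set (EuclideanSpace ℝ (Fin d))}
    (hH : IsClosed H) (hb : Bornology.IsBounded H) (hc : ∀ y ∈ H, y - c ∈ V)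
    {ξ : ℕ → EuclideanSpace ℝ (Fin d)}
    (h0 : Tendsto (fun n => V.orthogonalProjectionOnto (ξ n)) atTop (𝓝 0))
    (h1 : Tendsto (fun n => expo (ξ n) c) atTop (𝓝 1)) :
    Tendsto (fun n => pieceIntegral k H (ξ n)) atTop (𝓝 (pieceIntegral k H 0)) := by
  simp only [pieceIntegral, setIntegral_euclideanHausdorffMeasure hk hH.measurableSet hc]
  have hmeas : ∀ f : EuclideanSpace ℝ (Fin d) → ℂ, Continuous f →
      AEStronglyMeasurable (fun v : V => H.indicator f (c + v)) := fun f hf =>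
    ((hf.measurable.indicator hH.measurableSet).comp (by fun_prop :
      Measurable fun v : V => c + (v : EuclideanSpace ℝ (Fin d)))).aestronglyMeasurable
  obtain ⟨B, hB⟩ := hb.exists_norm_le
  have hint : Integrable (fun v : V => H.indicator (fun _ => (1 : ℂ)) (c + v)) := by
    refine integrable_of_norm_le_of_bounded (B := B + ‖c‖) (C := 1) (hmeas _ continuous_const) ?_ ?_
    · intro v
      exact (norm_indicator_le_norm_self _ _).trans (by simp)
    · intro v hv
      have h2 := hB _ (Set.mem_of_indicator_ne_zero hv)
      have : (v : EuclideanSpace ℝ (Fin d)) = (c + v) - c := by abel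
      change ‖(v : EuclideanSpace ℝ (Fin d))‖ ≤ _
      rw [this]
      exact (norm_sub_le _ _).trans (by gcongr)
  refine tendsto_integral_of_dominated_convergence _ (fun n => hmeas _ (continuous_expo _))
    hint.norm (fun n => Eventually.of_forall fun v => ?_) (Eventually.of_forall fun v => ?_)
  · by_cases h : c + (v : EuclideanSpace ℝ (Fin d)) ∈ H
    · rw [Set.indicator_of_mem h, Set.indicator_of_mem h, norm_expo, norm_one]
    · rw [Set.indicator_of_notMem h, Set.indicator_of_notMem h]
  · by_cases h : c + (v : EuclideanSpace ℝ (Fin d)) ∈ H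
    · simp only [Set.indicator_of_mem h, expo_add]
      have e0 : ∀ x : EuclideanSpace ℝ (Fin d), expo 0 x = 1 := fun x => by simp [expo]
      rw [e0, e0]
      refine h1.mul ?_
      have h2 : Tendsto (fun n => (inner ℝ (V.orthogonalProjectionOnto (ξ n)) v : ℝ)) atTop
          (𝓝 0) := by
        simpa using Filter.Tendsto.inner (𝕜 := ℝ) h0 (tendsto_const_nhds (x := v))
      have h3 : Continuous fun s : ℝ => Complex.exp (2 * Real.pi * Complex.I * (s : ℂ)) := by
        fun_prop
      have h4 := (h3.tendsto 0).comp h2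
      simp only [Complex.ofReal_zero, mul_zero, Complex.exp_zero] at h4
      refine h4.congr fun n => ?_
      simp only [Function.comp_apply, inner_orthogonalProjectionOnto]
      rfl
    · simp only [Set.indicator_of_notMem h]
      exact tendsto_const_nhds

/-- A sequence of frequencies with bounded projections has arbitrarily late differences that are
almost periods of a given finite family of Fourier integrals over pieces parallel to `V`. -/
theorem exists_tendsto_pieceIntegral {ι : Type*} [Finite ι]
    {V : Submodule ℝ (EuclideanSpace ℝ (Fin d))} {k : ℕ} (hk : Module.finrank ℝ V = k)
    {c : ι → EuclideanSpace ℝ (Fin d)} {H : ι → Set (EuclideanSpace ℝ (Fin d))}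
    (hH : ∀ i, IsClosed (H i)) (hb : ∀ i, Bornology.IsBounded (H i))
    (hc : ∀ i, ∀ y ∈ H i, y - c i ∈ V) {R : ℝ} {ξ : ℕ → EuclideanSpace ℝ (Fin d)}
    (hξ : ∀ n, ‖V.orthogonalProjectionOnto (ξ n)‖ ≤ R) :
    ∃ φ : ℕ → ℕ, StrictMono φ ∧ ∀ i, Tendsto
      (fun n => pieceIntegral k (H i) (ξ (φ (n + 1)) - ξ (φ n))) atTop
      (𝓝 (pieceIntegral k (H i) 0)) := by
  have := Fintype.ofFinite ι
  -- Projections and phases together range over a compact set, so both converge along one common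
  -- subsequence.
  have hcomp : IsCompact (Metric.closedBall (0 : V) R ×ˢ Metric.closedBall (0 : ι → ℂ) 1) :=
    (isCompact_closedBall _ _).prod (isCompact_closedBall _ _)
  obtain ⟨a, -, φ, hφ, hlim⟩ := hcomp.tendsto_subseq
    (x := fun n => (V.orthogonalProjectionOnto (ξ n), fun i => expo (ξ n) (c i))) (fun n => by
      refine ⟨by simpa using hξ n, ?_⟩
      rw [mem_closedBall_zero_iff, pi_norm_le_iff_of_nonneg zero_le_one]
      exact fun i => (norm_expo _ _).le)
  refine ⟨φ, hφ, fun i => tendsto_pieceIntegral hk (hH i) (hb i) (hc i) ?_ ?_⟩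
  · have h1 : Tendsto (fun n => V.orthogonalProjectionOnto (ξ (φ n))) atTop (𝓝 a.1) :=
      (continuous_fst.tendsto a).comp hlim
    have h2 := (h1.comp (tendsto_add_atTop_nat 1)).sub h1
    rw [sub_self] at h2
    exact h2.congr fun n => by simp
  · have h1 : Tendsto (fun n => expo (ξ (φ n)) (c i)) atTop (𝓝 (a.2 i)) :=
      ((continuous_apply i).tendsto a.2).comp ((continuous_snd.tendsto a).comp hlim)
    have hnorm : ‖a.2 i‖ = 1 :=
      tendsto_nhds_unique h1.norm (by simp only [norm_expo]; exact tendsto_const_nhds)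
    -- The phase of a difference is a phase times a conjugate phase; its limit is `|a|² = 1`.
    have h2 := (h1.comp (tendsto_add_atTop_nat 1)).mul
      ((Complex.continuous_conj.tendsto _).comp h1)
    have h3 : a.2 i * (starRingEnd ℂ) (a.2 i) = 1 := by
      rw [Complex.mul_conj, Complex.normSq_eq_norm_sq, hnorm]
      simp
    rw [h3] at h2
    refine h2.congr fun n => ?_
    simp only [Function.comp_apply]
    rw [star_expo, ← expo_add_left, sub_eq_add_neg]

theorem faceSum_zero {Φ : RFlag d r} {A : Set (EuclideanSpace ℝ (Fin d))}
    (hfin : (sequencesTo Φ d A).Finite) : faceSum Φ d A 0 = (functional Φ A : ℂ) := by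
  have e0 : ∀ H : Set (EuclideanSpace ℝ (Fin d)), pieceIntegral r H 0 =
      (((Measure.euclideanHausdorffMeasure r).real H : ℝ) : ℂ) := fun H => by
    simp [pieceIntegral, expo]
  have e1 : faceSequences Φ A = sequencesTo Φ d A := rfl
  rw [faceSum, functional, e1, finsum_mem_eq_finite_toFinset_sum _ hfin,
    finsum_mem_eq_finite_toFinset_sum _ hfin, Complex.ofReal_sum]
  refine Finset.sum_congr rfl fun F _ => ?_
  rw [e0, Complex.ofReal_mul]

end Main

end Hadwiger

end

/-! ### Conclusion: orthogonality against the asymptotics -/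

theorem theorem1p2 (d r : ℕ) (hr : 1 ≤ r) (hrd : r + 1 ≤ d)
    (A : Set (EuclideanSpace ℝ (Fin d))) (hA : Hadwiger.IsPolytope A)
    (hS : Hadwiger.IsSpectral A) (Φ : Hadwiger.RFlag d r) :
    (Hadwiger.faceSequences Φ A).Finite ∧ Hadwiger.functional Φ A = 0 := by
  obtain ⟨hb, -, hpos, Λ, hΛ⟩ := hS
  obtain ⟨L, hL⟩ := hA.exists_isAdapted (by omega)
  obtain ⟨u, hu⟩ := Hadwiger.exists_isNormals Φ
  have htop : Φ.V d = ⊤ := Submodule.eq_top_of_finrank_eq (by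
    rw [Φ.finrank_eq d (by omega) le_rfl, finrank_euclideanSpace_fin])
  rw [← htop] at hL
  obtain ⟨hfin, hpieces, hasym⟩ :=
    Hadwiger.finite_sequencesTo_and_asymptotics hu (by omega : r ≤ d) le_rfl 0 L A hL
  refine ⟨hfin, ?_⟩
  obtain ⟨R, hR⟩ := hΛ.exists_norm_sub_le hb
    (hA.interior_nonempty (nonempty_of_measure_ne_zero hpos.ne'))
  have key : ∀ ε : ℝ, 0 < ε → ‖Hadwiger.faceSum Φ d A 0‖ ≤ ε := by
    intro ε hε
    obtain ⟨T, hT⟩ := hasym ε hε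
    obtain ⟨ξ, hξ, hlac⟩ := exists_seq_of_forall_finset_exists
      (fun ξ => ξ ∈ Λ ∧ ‖(Φ.V r).orthogonalProjectionOnto ξ‖ ≤ R)
      -- The lower bound `1` on the threshold forces terms of the sequence with different indices to
      -- be distinct.
      (fun ξ η => Hadwiger.IsLacunary Φ u (fun M => max (T M) 1) d (η - ξ)) (by
        intro s _
        obtain ⟨B, hB⟩ := s.finite_toSet.isBounded.exists_norm_le
        -- Radius `R + B`: the chosen point of the spectrum lies within `R` of `p`, and the earlier
        -- terms have norm at most `B`. Since `p` projects to `0` in `V r`, the new projection is at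
        -- most `R`.
        obtain ⟨p, -, hp0, hp⟩ := Hadwiger.exists_forall_norm_sub_le_isLacunary hu
          (fun M => max (T M) 1) (R + B) (by omega : r ≤ d) le_rfl
        obtain ⟨η, hη, hηp⟩ := hR p
        refine ⟨η, ⟨hη, ?_⟩, fun x hx => hp _ ?_⟩
        · have : (Φ.V r).orthogonalProjectionOnto η =
              (Φ.V r).orthogonalProjectionOnto (η - p) := by
            rw [map_sub, hp0, sub_zero]
          rw [this]
          exact (Submodule.norm_orthogonalProjectionOnto_apply_le _ _).trans hηp
        · rw [sub_right_comm]
          exact (norm_sub_le _ _).trans (add_le_add hηp (hB x hx)))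
    have hsmall : ∀ m n, m < n → ‖Hadwiger.faceSum Φ d A (ξ n - ξ m)‖ ≤ ε := by
      intro m n hmn
      have h1 := hT _ ((hlac m n hmn).mono (fun M => le_max_left _ _) le_rfl)
      have hne : ξ n ≠ ξ m := by
        intro h
        obtain ⟨M, -, hM⟩ := hlac m n hmn r le_rfl (by omega)
        rw [h, sub_self, inner_zero_left, abs_zero] at hM
        exact absurd ((le_max_right _ _).trans hM) (by norm_num)
      -- By orthogonality the main term of the asymptotics vanishes, leaving `faceSum` alone.
      have h0 : Hadwiger.pieceIntegral d A (ξ n - ξ m) = 0 := by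
        rw [Hadwiger.pieceIntegral, EuclideanSpace.euclideanHausdorffMeasure_eq_volume]
        exact hΛ.integral_expo_sub_eq_zero (hξ n).1 (hξ m).1 hne
      rwa [h0, mul_zero, zero_sub, norm_neg] at h1
    have : Finite (Hadwiger.sequencesTo Φ d A) := hfin
    choose c L' hc using fun F : Hadwiger.sequencesTo Φ d A => hpieces F F.2
    obtain ⟨φ, hφ, hlim⟩ := Hadwiger.exists_tendsto_pieceIntegral
      (Φ.finrank_eq r le_rfl (by omega)) (H := fun F : Hadwiger.sequencesTo Φ d A => F.1 r)
      (fun F => (hc F).isClosed) (fun F => (hc F).isBounded) (fun F => (hc F).sub_mem)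
      fun n => (hξ n).2
    have hlim' : Tendsto (fun n => Hadwiger.faceSum Φ d A (ξ (φ (n + 1)) - ξ (φ n))) atTop
        (𝓝 (Hadwiger.faceSum Φ d A 0)) := by
      simp only [Hadwiger.faceSum, finsum_mem_eq_finite_toFinset_sum _ hfin]
      refine tendsto_finsetSum _ fun F hF => ?_
      exact (hlim ⟨F, hfin.mem_toFinset.1 hF⟩).const_mul _
    exact le_of_tendsto hlim'.norm
      (Eventually.of_forall fun n => hsmall _ _ (hφ (Nat.lt_succ_self n)))
  have h0 : Hadwiger.faceSum Φ d A 0 = 0 :=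
    norm_le_zero_iff.1 (le_of_forall_pos_le_add fun ε hε => by simpa using key ε hε)
  rw [Hadwiger.faceSum_zero hfin] at h0
  exact_mod_cast h0
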